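/- Conventions. Let $\mathcal H$ be a complex Hilbert space and $A$ a closed Hermitian operator in $\mathcal H$ (that is, $(Ax,y)=(x,Ay)$ for $x,y\in\operatorname{dom}A$; $A$ need not be densely defined). Put $\mathcal H_0=\overline{\operatorname{dom}A}$ and let $A^*$ be the adjoint of $A:\mathcal H_0\to\mathcal H$, an operator from $\mathcal H$ into $\mathcal H_0$. The rigged Hilbert space $\mathcal H_+\subset\mathcal H\subset\mathcal H_-$ associated with $A$ consists of $\mathcal H_+=\operatorname{dom}A^*$ with $(f,g)_+=(f,g)+(A^*f,A^*g)$ and of its dual space $\mathcal H_-$ (continuous antilinear functionals, $h\in\mathcal H$ being identified with $f\mapsto(h,f)$). The Riesz–Berezanskii operator is the isometry $R$ of $\mathcal H_-$ onto $\mathcal H_+$ with $(Rx,u)_+=(x,u)$ for $x\in\mathcal H_-$, $u\in\mathcal H_+$. $[X,Y]$ denotes the bounded linear operators from $X$ to $Y$, and adjoints of operators between these spaces are taken with respect to the pairing of $\mathcal H_+$ and $\mathcal H_-$. An operator $\mathbb D\in[\mathcal H_+,\mathcal H_-]$ is a self-adjoint bi-extension of $A$ if $\mathbb D\supset A$, $\mathbb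 D^*\supset A$, $\mathbb D=\mathbb D^*$, and $\{(x,\mathbb Dx): x\in\mathcal H_+,\ \mathbb Dx\in\mathcal H\}$ is the graph of a self-adjoint extension of $A$ in $\mathcal H$. For $F_+\in[\mathcal H_+,\mathcal H_+]$ and $K\in[\mathcal E,\mathcal H_-]$, $\rho(\mathbb D,F_+,K)$ is the set of all $z\in\mathbb C$ such that $(\mathbb D-zF_+)^{-1}$ exists on $\mathcal H\cup\operatorname{ran}K$ (equivalently, on $\mathcal H+\operatorname{ran}K$) and is continuous there from the norm of $\mathcal H_-$ to the norm of $\mathcal H$. Theorem. Let $\mathcal E$ be a finite-dimensional complex Hilbert space and let $V$ be a Herglotz–Nevanlinna function with values in $[\mathcal E,\mathcal E]$ (holomorphic on $\mathbb C\setminus\mathbb R$, $V(z)^*=V(\bar z)$, and $\operatorname{Im}V(z)\ge 0$ for $\operatorname{Im}z>0$) with the integral representation $$V(z)=Q+\int_{\mathbb R}\Big(\frac1{t-z}-\frac{t}{1+t^2}\Big)\,d\Sigma(t),\qquad z\in\mathbb C\setminus\mathbb R,$$ where $Q=Q^*$ and $\Sigma:\mathbb R\to[\mathcal E,\mathcal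 E]$ is nondecreasing (its increments are nonnegative operators) with $\int_{\mathbb R}\frac{(d\Sigma(t)x,x)}{1+t^2}<\infty$ for all $x\in\mathcal E$. Then there exist a Hilbert space $\mathcal H$, a closed Hermitian operator $A$ in $\mathcal H$ with associated rigged Hilbert space $\mathcal H_+\subset\mathcal H\subset\mathcal H_-$, a self-adjoint bi-extension $\mathbb D\in[\mathcal H_+,\mathcal H_-]$ of $A$, an operator $F_+$ that is an orthogonal projection in $\mathcal H_+$ and in $\mathcal H$, and an injective $K\in[\mathcal E,\mathcal H_-]$ (with adjoint $K^*\in[\mathcal H_+,\mathcal E]$), such that $\rho(\mathbb D,F_+,K)$ is open (so that these data form an impedance system), $\mathbb C\setminus\mathbb R\subset\rho(\mathbb D,F_+,K)$, and $$V(z)=K^*(\mathbb D-zF_+)^{-1}K,\qquad z\in\mathbb C\setminus\mathbb R.$$ Moreover, these operators can be chosen so that, in addition, $F_-\mathbb D=\mathbb DF_+$, where $F_-=R^{-1}F_+R\in[\mathcal H_-,\mathcal H_-]$. -/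

import Mathlib

open scoped InnerProductSpace ComplexConjugate

universe u

noncomputable section

/-! ### Herglotz–Nevanlinna functions and their integral representation -/

section Herglotz

variable {E : Type*} [NormedAddCommGroup E] [InnerProductSpace ℂ E]

/-- Operator-valued Herglotz–Nevanlinna functions on `ℂ ∖ ℝ`. -/
structure IsHerglotzNevanlinna [CompleteSpace E] (V : ℂ → E →L[ℂ] E) : Prop where
  holomorphic : DifferentiableOn ℂ V {z | z.im ≠ 0}
  symmetric : ∀ z : ℂ, z.im ≠ 0 → ContinuousLinearMap.adjoint (V z) = V (conj z)
  im_nonneg : ∀ z : ℂ, 0 < z.im →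
    ((2 * Complex.I)⁻¹ • (V z - ContinuousLinearMap.adjoint (V z))).IsPositive

lemma monotone_quadraticForm {S : ℝ → E →L[ℂ] E} (hS : Monotone S) (x : E) :
    Monotone fun t => (⟪x, S t x⟫_ℂ).re := by
  intro s t hst
  have h := (ContinuousLinearMap.le_def _ _).1 (hS hst)
  have h2 := h.re_inner_nonneg_right x
  simp only [sub_apply, inner_sub_right, map_sub, RCLike.re_to_complex] at h2
  simpa using h2

/-- The Lebesgue–Stieltjes measure `(dΣ(t) x, x)` of a function `Σ` that is nondecreasing in the
Loewner order. -/
def quadraticMeasure (S : ℝ → E →L[ℂ] E) (hS : Monotone S) (x : E) : MeasureTheory.Measure ℝ :=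
  (monotone_quadraticForm hS x).stieltjesFunction.measure

/-- `T = ∫ φ(t) dΣ(t)`: the operator `T` is the operator-valued Stieltjes integral of `φ`, i.e.
`(T x, x) = ∫ φ(t) (dΣ(t) x, x)` for all `x`; over `ℂ` this determines `T`. -/
def IsStieltjesIntegral (S : ℝ → E →L[ℂ] E) (hS : Monotone S) (φ : ℝ → ℂ) (T : E →L[ℂ] E) : Prop :=
  ∀ x : E, MeasureTheory.Integrable φ (quadraticMeasure S hS x) ∧
    ⟪x, T x⟫_ℂ = ∫ t, φ t ∂(quadraticMeasure S hS x)

end Herglotz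

/-! ### The rigged Hilbert space of a closed Hermitian operator -/

namespace Rigged

variable {H : Type*} [NormedAddCommGroup H] [InnerProductSpace ℂ H]

/-- `(A x, y) = (x, A y)` on the (not necessarily dense) domain of `A`. -/
def IsHermitian (A : H →ₗ.[ℂ] H) : Prop :=
  ∀ x y : A.domain, ⟪A x, (y : H)⟫_ℂ = ⟪(x : H), A y⟫_ℂ

/-- `H₀`, the closure of the domain of `A`. -/
abbrev DomClosure (A : H →ₗ.[ℂ] H) : Submodule ℂ H := A.domain.topologicalClosure

/-- `A` as an operator from `H₀` into `H`. -/
def fromDomClosure (A : H →ₗ.[ℂ] H) : DomClosure A →ₗ.[ℂ] H where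
  domain := A.domain.comap (DomClosure A).subtype
  toFun := A.toFun ∘ₗ (DomClosure A).subtype.restrict (fun _ hx => hx)

lemma dense_fromDomClosure (A : H →ₗ.[ℂ] H) :
    Dense ((fromDomClosure A).domain : Set (DomClosure A)) := by
  intro x
  rw [closure_subtype]
  have h : ((↑) '' ((fromDomClosure A).domain : Set (DomClosure A)) : Set H) = A.domain := by
    ext y
    constructor
    · rintro ⟨w, hw, rfl⟩
      exact hw
    · intro hy
      exact ⟨⟨y, A.domain.le_topologicalClosure hy⟩, hy, rfl⟩
  rw [h]
  exact x.2

variable [CompleteSpace H]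

/-- The adjoint `A*`, an operator from `H` into `H₀`. -/
def adj (A : H →ₗ.[ℂ] H) : H →ₗ.[ℂ] DomClosure A := (fromDomClosure A).adjoint

/-- `H₊`: the domain of `A*`, with the graph inner product. -/
def Plus (A : H →ₗ.[ℂ] H) : Type _ := (adj A).domain

variable (A : H →ₗ.[ℂ] H)

instance : AddCommGroup (Plus A) := inferInstanceAs (AddCommGroup (adj A).domain)

instance : Module ℂ (Plus A) := inferInstanceAs (Module ℂ (adj A).domain)

/-- The inclusion `H₊ ⊂ H`, as a linear map. -/
def Plus.incl : Plus A →ₗ[ℂ] H := (adj A).domain.subtype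

/-- `A*` on `H₊`. -/
def Plus.adj : Plus A →ₗ[ℂ] DomClosure A := (Rigged.adj A).toFun

/-- `(f, g)₊ = (f, g) + (A* f, A* g)`. -/
abbrev Plus.core : InnerProductSpace.Core ℂ (Plus A) where
  inner f g := ⟪Plus.incl A f, Plus.incl A g⟫_ℂ + ⟪Plus.adj A f, Plus.adj A g⟫_ℂ
  conj_inner_symm f g := by simp
  re_inner_nonneg f := by
    rw [map_add]
    exact add_nonneg inner_self_nonneg inner_self_nonneg
  add_left f g h := by
    simp only [map_add, inner_add_left]
    ring
  smul_left f g r := by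
    simp only [map_smul, inner_smul_left]
    ring
  definite f h := by
    have h' := congrArg RCLike.re h
    rw [map_add, map_zero] at h'
    have h1 : RCLike.re ⟪Plus.incl A f, Plus.incl A f⟫_ℂ = 0 := by
      have := inner_self_nonneg (𝕜 := ℂ) (x := Plus.incl A f)
      have := inner_self_nonneg (𝕜 := ℂ) (x := Plus.adj A f)
      linarith
    rw [inner_self_eq_norm_sq, sq_eq_zero_iff, norm_eq_zero] at h1
    exact Subtype.ext h1

instance : NormedAddCommGroup (Plus A) := (Plus.core A).toNormedAddCommGroup

instance : InnerProductSpace ℂ (Plus A) := InnerProductSpace.ofCore (Plus.core A).toCore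

lemma Plus.inner_def (f g : Plus A) :
    ⟪f, g⟫_ℂ = ⟪Plus.incl A f, Plus.incl A g⟫_ℂ + ⟪Plus.adj A f, Plus.adj A g⟫_ℂ := rfl

lemma Plus.norm_sq (f : Plus A) : ‖f‖ ^ 2 = ‖Plus.incl A f‖ ^ 2 + ‖Plus.adj A f‖ ^ 2 := by
  rw [← inner_self_eq_norm_sq (𝕜 := ℂ), Plus.inner_def, map_add, inner_self_eq_norm_sq,
    inner_self_eq_norm_sq]

/-- The graph of `A*` as an isometric image of `H₊`. -/
def Plus.toGraph : Plus A →ₗᵢ[ℂ] WithLp 2 (H × DomClosure A) where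
  toLinearMap := (WithLp.linearEquiv 2 ℂ (H × DomClosure A)).symm.toLinearMap ∘ₗ
    (Plus.incl A).prod (Plus.adj A)
  norm_map' f := by
    rw [← sq_eq_sq₀ (norm_nonneg _) (norm_nonneg _), Plus.norm_sq, WithLp.prod_norm_sq_eq_of_L2]
    rfl

instance : CompleteSpace (Plus A) := by
  rw [completeSpace_iff_isComplete_range (Plus.toGraph A).isometry.isUniformInducing]
  have hc : IsClosed ((Rigged.adj A).graph : Set (H × DomClosure A)) :=
    LinearPMap.adjoint_isClosed (dense_fromDomClosure A)
  have hr : Set.range (Plus.toGraph A) =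
      (WithLp.ofLp : WithLp 2 (H × DomClosure A) → _) ⁻¹' ((Rigged.adj A).graph : Set _) := by
    ext p
    constructor
    · rintro ⟨f, rfl⟩
      exact (Rigged.adj A).mem_graph f
    · intro hp
      obtain ⟨f, h1, h2⟩ := ((Rigged.adj A).mem_graph_iff).1 hp
      refine ⟨f, (WithLp.ofLp_injective 2) ?_⟩
      exact Prod.ext h1 h2
  rw [hr]
  exact (hc.preimage (WithLp.prod_continuous_ofLp 2 H (DomClosure A))).isComplete

/-- The inclusion `H₊ ⊂ H`, as a bounded operator. -/
def Plus.inclL : Plus A →L[ℂ] H :=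
  (Plus.incl A).mkContinuous 1 fun f => by
    rw [one_mul, ← sq_le_sq₀ (norm_nonneg _) (norm_nonneg _), Plus.norm_sq]
    nlinarith [sq_nonneg ‖Plus.adj A f‖]

/-- `H₋`: the dual of `H₊`. The continuous functionals are taken antilinear, so that `H` embeds
linearly; `φ f` is the pairing `(φ, f)`, linear in `φ` and antilinear in `f`. -/
abbrev Minus : Type _ := Plus A →L⋆[ℂ] ℂ

/-- The inclusion `H ⊂ H₋`: `h` is the functional `f ↦ (h, f)`. -/
def toMinus : H →ₗ[ℂ] Minus A where
  toFun h := (innerSLFlip ℂ h).comp (Plus.inclL A)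
  map_add' _ _ := by ext; simp
  map_smul' _ _ := by ext; simp

lemma toMinus_apply (h : H) (f : Plus A) : toMinus A h f = ⟪Plus.incl A f, h⟫_ℂ := rfl

lemma exists_riesz (φ : Minus A) : ∃ v : Plus A, innerSLFlip ℂ v = φ := by
  let ψ : StrongDual ℂ (Plus A) :=
    { toFun := fun f => conj (φ f)
      map_add' := by intros; simp
      map_smul' := by intros; simp
      cont := Complex.continuous_conj.comp φ.continuous }
  refine ⟨(InnerProductSpace.toDual ℂ (Plus A)).symm ψ, ?_⟩
  ext f
  rw [innerSLFlip_apply_apply, ← inner_conj_symm, InnerProductSpace.toDual_symm_apply]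
  simp [ψ]

/-- The inverse `R⁻¹ : H₊ → H₋` of the Riesz–Berezanskii operator: `(R⁻¹ v, u) = (v, u)₊`. -/
def rieszInv : Plus A ≃ₗᵢ[ℂ] Minus A :=
  LinearIsometryEquiv.ofSurjective
    { toLinearMap := (innerSLFlip ℂ : Plus A →L[ℂ] Minus A).toLinearMap
      norm_map' := fun v => by
        refine ContinuousLinearMap.opNorm_eq_of_bounds (norm_nonneg _)
          (fun f => ?_) fun N hN h => ?_
        · simpa [mul_comm] using norm_inner_le_norm (𝕜 := ℂ) f v
        · rcases eq_or_ne v 0 with rfl | hv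
          · simpa using hN
          · have h1 := h v
            have h2 : ‖⟪v, v⟫_ℂ‖ ≤ N * ‖v‖ := h1
            rw [← inner_self_re_eq_norm, inner_self_eq_norm_mul_norm] at h2
            exact le_of_mul_le_mul_right h2 (norm_pos_iff.2 hv) }
    (exists_riesz A)

/-- The Riesz–Berezanskii operator, the isometry `R` of `H₋` onto `H₊` with `(R x, u)₊ = (x, u)`. -/
def riesz : Minus A ≃ₗᵢ[ℂ] Plus A := (rieszInv A).symm

lemma rieszInv_apply (v u : Plus A) : rieszInv A v u = ⟪u, v⟫_ℂ := rfl

lemma inner_riesz (φ : Minus A) (u : Plus A) : ⟪u, riesz A φ⟫_ℂ = φ u := by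
  rw [← rieszInv_apply, riesz, LinearIsometryEquiv.apply_symm_apply]

variable {A}

/-- The adjoint `𝔸* ∈ [H₊, H₋]` of `𝔸 ∈ [H₊, H₋]` with respect to the pairing of `H₊` and `H₋`,
see `adjPM_apply`. -/
def adjPM (D : Plus A →L[ℂ] Minus A) : Plus A →L[ℂ] Minus A :=
  (riesz A).symm.toContinuousLinearEquiv.toContinuousLinearMap ∘L
    ContinuousLinearMap.adjoint
      ((riesz A).toContinuousLinearEquiv.toContinuousLinearMap ∘L D)

lemma adjPM_apply (D : Plus A →L[ℂ] Minus A) (f g : Plus A) : adjPM D g f = conj (D f g) := by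
  refine (ContinuousLinearMap.adjoint_inner_right
    ((riesz A).toContinuousLinearEquiv.toContinuousLinearMap ∘L D) f g).trans ?_
  rw [← inner_conj_symm]
  exact congrArg _ (inner_riesz A (D f) g)

/-- `𝔸 ⊃ A`. -/
def Extends (D : Plus A →L[ℂ] Minus A) : Prop :=
  ∀ x : A.domain, ∃ f : Plus A, Plus.incl A f = x ∧ D f = toMinus A (A x)

/-- `𝔸` is a self-adjoint bi-extension of `A`: `𝔸 ⊃ A`, `𝔸* ⊃ A`, `𝔸 = 𝔸*`, and
`{(x, 𝔸 x) : x ∈ H₊, 𝔸 x ∈ H}` is (the graph of) a self-adjoint extension of `A` in `H`. -/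
structure IsSelfAdjointBiExtension (D : Plus A →L[ℂ] Minus A) : Prop where
  extends_left : Extends D
  extends_right : Extends (adjPM D)
  selfAdjoint : adjPM D = D
  selfAdjoint_part : ∃ S : H →ₗ.[ℂ] H,
    (∀ x y : H, (x, y) ∈ S.graph ↔ ∃ f : Plus A, Plus.incl A f = x ∧ D f = toMinus A y) ∧
    IsSelfAdjoint S ∧ A ≤ S

/-- `F₊` is an orthogonal projection in `H₊` and in `H`: it is an orthogonal projection of `H₊`
and the restriction to `H₊` of an orthogonal projection of `H`. -/
def IsOrthogonalProjection (F : Plus A →L[ℂ] Plus A) : Prop :=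
  IsStarProjection F ∧
    ∃ P : H →L[ℂ] H, IsStarProjection P ∧ ∀ f : Plus A, Plus.incl A (F f) = P (Plus.incl A f)

/-- `𝔻 - z F₊` as an operator from `H₊` into `H₋`. -/
def pencil (D : Plus A →L[ℂ] Minus A) (F : Plus A →L[ℂ] Plus A) (z : ℂ) : Plus A →ₗ[ℂ] Minus A :=
  D.toLinearMap - z • (toMinus A ∘ₗ Plus.incl A ∘ₗ F.toLinearMap)

/-- `F₋ = R⁻¹ F₊ R`. -/
def minusOp (F : Plus A →L[ℂ] Plus A) : Minus A →L[ℂ] Minus A :=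
  (riesz A).symm.toContinuousLinearEquiv.toContinuousLinearMap ∘L F ∘L
    (riesz A).toContinuousLinearEquiv.toContinuousLinearMap

variable {E : Type*} [NormedAddCommGroup E] [InnerProductSpace ℂ E] [CompleteSpace E]

/-- The adjoint `K* ∈ [H₊, E]` of `K ∈ [E, H₋]`, see `inner_adjK`. -/
def adjK (K : E →L[ℂ] Minus A) : Plus A →L[ℂ] E :=
  ContinuousLinearMap.adjoint ((riesz A).toContinuousLinearEquiv.toContinuousLinearMap ∘L K)

lemma inner_adjK (K : E →L[ℂ] Minus A) (f : Plus A) (e : E) : ⟪adjK K f, e⟫_ℂ = K e f := by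
  rw [adjK, ContinuousLinearMap.adjoint_inner_left]
  exact inner_riesz A (K e) f

/-- `ρ(𝔻, F₊, K)`: the points `z` at which `(𝔻 - z F₊)⁻¹` exists on `H ∪ ran K`, equivalently on
the linear span `H + ran K`, and is continuous there from the norm of `H₋` to the norm of `H`. -/
def rho (D : Plus A →L[ℂ] Minus A) (F : Plus A →L[ℂ] Plus A) (K : E →L[ℂ] Minus A) : Set ℂ :=
  {z | (∀ y ∈ LinearMap.range (toMinus A) ⊔ LinearMap.range K.toLinearMap,
        ∃! f : Plus A, pencil D F z f = y) ∧
      ∃ C : ℝ, ∀ f : Plus A,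
        pencil D F z f ∈ LinearMap.range (toMinus A) ⊔ LinearMap.range K.toLinearMap →
        ‖Plus.incl A f‖ ≤ C * ‖pencil D F z f‖}

/-- Impedance systems (`Δ₊`-systems) `(𝔻 - z F₊) x = K φ₋`, `φ₊ = K* x` in the rigged Hilbert
space `H₊ ⊂ H ⊂ H₋` of a closed Hermitian operator `A`. -/
structure IsImpedanceSystem (A : H →ₗ.[ℂ] H) (D : Plus A →L[ℂ] Minus A) (F : Plus A →L[ℂ] Plus A)
    (K : E →L[ℂ] Minus A) : Prop where
  isClosed : A.IsClosed
  isHermitian : IsHermitian A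
  biExtension : IsSelfAdjointBiExtension D
  injective : Function.Injective K
  projection : IsOrthogonalProjection F
  isOpen_rho : IsOpen (rho D F K)

end Rigged

end

/-! The integral representation yields `V(z) - V(i) = (z - i) n* (B + i)(B - z)⁻¹ n`: write `dΣ =
s(t)² dσ` with a scalar measure `σ` (`exists_sqrt_density`), let `B` be multiplication by `t` in
`L²(σ; E)`, and put `n e = (t - i)⁻¹ s(t) e`, which is square integrable exactly because `(dΣ e,
e)/(1 + t²)` is finite.

Such an expression becomes a transfer function as follows (`IsPencilModel`). Let `B` be self-adjoint
and commute with an orthogonal projection `P`, let `B - zP` be boundedly invertible for nonreal `z`,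
and let `W ⊂ ran P` be finite-dimensional with `W ∩ dom B = 0`. Restrict `B` to the `x` with `(B +
iP)x ⟂ W` and call the result `A`. Then `dom A* = dom B ∔ W`, so vectors outside `dom B` are now
allowed in `H₊`, and the Hermitian form `(Bb, b' + w') + (w, Bb')` is a bi-extension `D` whose part
in `H` is `B`. With `F` the restriction of `P` and `K e = (D - iF) n e`, one has `(D - zF)⁻¹ K e = n
e + (z - i)(B - zP)⁻¹ P n e`, and applying `K*` gives `V(z) = K* n + (z - i) n* (B + iP)(B - zP)⁻¹ P
n`.

It remains to make `K* n` equal to `V(i)`. The skew part `i n*n` is right automatically because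
`V(i)* = V(-i)`. The self-adjoint discrepancy `Q` is supplied by an additional summand `E ⊕ E`
carrying the invertible operator `[[0, 1], [1, -Q]]`, on which `P` vanishes, so that it contributes
no dependence on `z`; it also makes `K` injective (`exists_impedanceSystem`). -/

noncomputable section

namespace Rigged

variable {H : Type*} [NormedAddCommGroup H] [InnerProductSpace ℂ H]

/-! ### The space `H₊` -/

section Plus

variable [CompleteSpace H] {A : H →ₗ.[ℂ] H}

lemma Plus.incl_injective : Function.Injective (Plus.incl A) := Subtype.val_injective

lemma Plus.inner_apply_incl (f : Plus A) (x : A.domain) :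
    ⟪A x, Plus.incl A f⟫_ℂ = ⟪(x : H), (Plus.adj A f : H)⟫_ℂ := by
  have h := LinearPMap.adjoint_isFormalAdjoint (dense_fromDomClosure A) f
    ⟨⟨x, A.domain.le_topologicalClosure x.2⟩, x.2⟩
  rw [← inner_conj_symm, ← inner_conj_symm (x : H)]
  exact congrArg conj h.symm

/-- `dom A` tests only the component of `h` in `H₀`, so it is this component that becomes `A* g`. -/
lemma Plus.exists_of_inner (g h : H) (hgh : ∀ x : A.domain, ⟪A x, g⟫_ℂ = ⟪(x : H), h⟫_ℂ) :
    ∃ f : Plus A, Plus.incl A f = g ∧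
      Plus.adj A f = (DomClosure A).orthogonalProjectionOnto h := by
  have key : ∀ x : (fromDomClosure A).domain,
      ⟪(DomClosure A).orthogonalProjectionOnto h, (x : DomClosure A)⟫_ℂ
        = ⟪g, fromDomClosure A x⟫_ℂ := by
    intro x
    rw [← inner_conj_symm, Submodule.inner_orthogonalProjectionOnto_eq_of_mem_left,
      ← inner_conj_symm g]
    exact congrArg conj (hgh ⟨x, x.2⟩).symm
  have hg : g ∈ (Rigged.adj A).domain :=
    LinearPMap.mem_adjoint_domain_of_exists g ⟨_, key⟩
  exact ⟨(⟨g, hg⟩ : (Rigged.adj A).domain), rfl,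
    LinearPMap.adjoint_apply_eq (dense_fromDomClosure A) _ key⟩

lemma norm_incl_le (f : Plus A) : ‖Plus.incl A f‖ ≤ ‖f‖ := by
  rw [← sq_le_sq₀ (norm_nonneg _) (norm_nonneg _), Plus.norm_sq]
  nlinarith [sq_nonneg ‖Plus.adj A f‖]

lemma norm_toMinus_le (h : H) : ‖toMinus A h‖ ≤ ‖h‖ := by
  refine ContinuousLinearMap.opNorm_le_bound _ (norm_nonneg _) fun f => ?_
  rw [toMinus_apply, mul_comm]
  exact (norm_inner_le_norm _ _).trans
    (mul_le_mul_of_nonneg_right (norm_incl_le f) (norm_nonneg _))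

end Plus

/-! ### Self-adjoint operators commuting with a projection -/

/-- `B - z P` is a bijection of the domain of `B` onto `H` whose inverse is bounded by `C`. -/
structure IsRegularPoint (B : H →ₗ.[ℂ] H) (P : H →L[ℂ] H) (z : ℂ) (C : ℝ) : Prop where
  surj : ∀ h : H, ∃ x : B.domain, B x - z • P x = h
  bound : ∀ x : B.domain, ‖(x : H)‖ ≤ C * ‖B x - z • P x‖

section RegularPoint

variable {B : H →ₗ.[ℂ] H} {P : H →L[ℂ] H}

lemma IsRegularPoint.mono {z : ℂ} {C C' : ℝ} (h : IsRegularPoint B P z C) (hC : C ≤ C') :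
    IsRegularPoint B P z C' :=
  ⟨h.surj, fun x => (h.bound x).trans (by gcongr)⟩

/-- Regular points are stable under small perturbations. -/
lemma IsRegularPoint.perturb [CompleteSpace H] (hP : ∀ x, ‖P x‖ ≤ ‖x‖) {z₀ z : ℂ} {C : ℝ}
    (hC : 0 < C) (h : IsRegularPoint B P z₀ C) (hz : C * ‖z - z₀‖ < 1) :
    IsRegularPoint B P z (C / (1 - C * ‖z - z₀‖)) := by
  have hinj : ∀ x y : B.domain, B x - z₀ • P x = B y - z₀ • P y → x = y := by
    intro x y hxy
    have h1 := h.bound (x - y)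
    rw [LinearPMap.map_sub, Submodule.coe_sub, map_sub, smul_sub, sub_sub_sub_comm, hxy, sub_self,
      norm_zero, mul_zero] at h1
    exact Subtype.ext (sub_eq_zero.1 (norm_le_zero_iff.1 h1))
  choose g hg using h.surj
  let L : H →ₗ[ℂ] H :=
    { toFun := fun k => g k
      map_add' := fun k l => by
        rw [← Submodule.coe_add]
        congr 1
        apply hinj
        rw [hg, LinearPMap.map_add, Submodule.coe_add, map_add, smul_add, add_sub_add_comm, hg, hg]
      map_smul' := fun c k => by
        rw [RingHom.id_apply, ← Submodule.coe_smul]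
        congr 1
        apply hinj
        rw [hg, LinearPMap.map_smul, Submodule.coe_smul, map_smul, smul_comm, ← smul_sub, hg] }
  let G : H →L[ℂ] H := L.mkContinuous C fun k => by
    have := h.bound (g k)
    rwa [hg] at this
  have hG : ‖G‖ ≤ C := LinearMap.mkContinuous_norm_le _ hC.le _
  -- Here `G` inverts `B - z₀P`, and `B - zP = (1 - (z - z₀) P G)(B - z₀P)`; a Neumann series
  -- inverts the first factor.
  have hnorm : ‖(z - z₀) • (P ∘L G)‖ < 1 := by
    refine lt_of_le_of_lt ?_ hz
    rw [norm_smul, mul_comm]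
    gcongr
    refine ContinuousLinearMap.opNorm_le_bound _ hC.le fun k => ?_
    exact (hP _).trans (G.le_of_opNorm_le hG k)
  refine ⟨fun k => ?_, fun x => ?_⟩
  · obtain ⟨u, hu⟩ := isUnit_one_sub_of_norm_lt_one hnorm
    have h1 : (1 - (z - z₀) • (P ∘L G)) ((↑u⁻¹ : H →L[ℂ] H) k) = k := by
      rw [← hu]
      exact congrArg (fun T : H →L[ℂ] H => T k) u.mul_inv
    refine ⟨g ((↑u⁻¹ : H →L[ℂ] H) k), ?_⟩
    set l := (↑u⁻¹ : H →L[ℂ] H) k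
    have h2 : l - (z - z₀) • P (g l) = k := h1
    have h3 := hg l
    rw [← h2]
    nth_rewrite 3 [← h3]
    rw [sub_smul]
    abel
  · have h1 := h.bound x
    have h2 : ‖B x - z₀ • P x‖ ≤ ‖B x - z • P x‖ + ‖z - z₀‖ * ‖(x : H)‖ := by
      have : B x - z₀ • P x = (B x - z • P x) + (z - z₀) • P x := by rw [sub_smul]; abel
      rw [this]
      refine (norm_add_le _ _).trans ?_
      rw [norm_smul]
      gcongr
      exact hP _
    rw [div_mul_eq_mul_div, le_div_iff₀ (by linarith)]
    nlinarith [mul_le_mul_of_nonneg_left h2 hC.le]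

end RegularPoint

/-- A symmetric operator `B` commuting with an orthogonal projection `P`, such that every nonreal
point is regular for the pencil `B - z P`, and a finite-dimensional subspace `W` of the range of `P`
that meets the domain of `B` trivially. -/
structure IsPencilModel [CompleteSpace H] (B : H →ₗ.[ℂ] H) (P : H →L[ℂ] H) (W : Submodule ℂ H) :
    Prop where
  hermitian : IsHermitian B
  proj : IsStarProjection P
  comm : ∀ x : B.domain, ∃ y : B.domain, (y : H) = P x ∧ B y = P (B x)
  regular : ∀ z : ℂ, z.im ≠ 0 → ∃ C, IsRegularPoint B P z C
  proj_eq : ∀ w ∈ W, P w = w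
  disjoint : ∀ w ∈ W, w ∈ B.domain → w = 0
  finite : FiniteDimensional ℂ W

/-- The restriction of `B` to the vectors `x` with `(B + i P) x ⟂ W`. -/
def restr (B : H →ₗ.[ℂ] H) (P : H →L[ℂ] H) (W : Submodule ℂ H) : H →ₗ.[ℂ] H where
  domain := (Wᗮ.comap (B.toFun + Complex.I • (P.toLinearMap ∘ₗ B.domain.subtype))).map
    B.domain.subtype
  toFun := B.toFun ∘ₗ Submodule.inclusion (Submodule.map_subtype_le _ _)

lemma mem_restr_iff {B : H →ₗ.[ℂ] H} {P : H →L[ℂ] H} {W : Submodule ℂ H} (x : B.domain) :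
    (x : H) ∈ (restr B P W).domain ↔ ∀ w ∈ W, ⟪B x + Complex.I • P x, w⟫_ℂ = 0 := by
  simp only [restr, Submodule.mem_map]
  constructor
  · rintro ⟨y, hy, hxy⟩ w hw
    obtain rfl : y = x := Subtype.ext hxy
    exact (Submodule.mem_orthogonal' _ _).1 hy w hw
  · intro h
    exact ⟨x, (Submodule.mem_orthogonal' _ _).2 h, rfl⟩

lemma restr_le (B : H →ₗ.[ℂ] H) (P : H →L[ℂ] H) (W : Submodule ℂ H) : restr B P W ≤ B :=
  ⟨Submodule.map_subtype_le _ _, fun x y hxy => by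
    change B.toFun _ = B.toFun _
    congr 1
    exact Subtype.ext hxy⟩

lemma exists_of_mem_restr {B : H →ₗ.[ℂ] H} {P : H →L[ℂ] H} {W : Submodule ℂ H}
    (x : (restr B P W).domain) : ∃ y : B.domain, (y : H) = x ∧ B y = restr B P W x ∧
      ∀ w ∈ W, ⟪B y + Complex.I • P y, w⟫_ℂ = 0 := by
  refine ⟨⟨x, (restr_le B P W).1 x.2⟩, rfl, ((restr_le B P W).2 rfl).symm, ?_⟩
  exact (mem_restr_iff (⟨x, (restr_le B P W).1 x.2⟩ : B.domain)).1 x.2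

lemma restr_apply {B : H →ₗ.[ℂ] H} {P : H →L[ℂ] H} {W : Submodule ℂ H} (x : B.domain)
    (hx : (x : H) ∈ (restr B P W).domain) : restr B P W ⟨x, hx⟩ = B x :=
  (restr_le B P W).2 rfl

lemma mem_graph_restr_iff {B : H →ₗ.[ℂ] H} {P : H →L[ℂ] H} {W : Submodule ℂ H} (p : H × H) :
    p ∈ (restr B P W).graph ↔ p ∈ B.graph ∧ ∀ w ∈ W, ⟪p.2 + Complex.I • P p.1, w⟫_ℂ = 0 := by
  simp only [LinearPMap.mem_graph_iff]
  constructor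
  · rintro ⟨y, h1, h2⟩
    obtain ⟨x, hx, hx', hw⟩ := exists_of_mem_restr y
    refine ⟨⟨x, hx.trans h1, hx'.trans h2⟩, ?_⟩
    rw [← h1, ← h2, ← hx, ← hx']
    exact hw
  · rintro ⟨⟨x, h1, h2⟩, hw⟩
    rw [← h1, ← h2] at hw
    exact ⟨⟨x, (mem_restr_iff x).2 hw⟩, h1, (restr_apply x _).trans h2⟩

/-! ### Self-adjointness of `B` and the restricted operator `A`. -/

namespace IsPencilModel

variable [CompleteSpace H] {B : H →ₗ.[ℂ] H} {P : H →L[ℂ] H} {W : Submodule ℂ H}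
  (hM : IsPencilModel B P W)

include hM

lemma inner_proj (x y : H) : ⟪P x, y⟫_ℂ = ⟪x, P y⟫_ℂ := by
  rw [← ContinuousLinearMap.adjoint_inner_right]
  congr 2
  exact hM.proj.isSelfAdjoint.adjoint_eq

lemma proj_proj (x : H) : P (P x) = P x :=
  congrArg (fun T : H →L[ℂ] H => T x) hM.proj.isIdempotentElem

lemma norm_proj_le (x : H) : ‖P x‖ ≤ ‖x‖ := by
  by_cases h0 : P x = 0
  · simp [h0]
  have h : ‖P x‖ * ‖P x‖ ≤ ‖x‖ * ‖P x‖ := by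
    rw [← inner_self_eq_norm_mul_norm (𝕜 := ℂ), hM.inner_proj, hM.proj_proj]
    exact (re_inner_le_norm _ _)
  exact le_of_mul_le_mul_right h (norm_pos_iff.2 h0)

/-- Surjectivity of `B ± iP` forces `B* ⊂ B`: if `(B - iP)b = h - iPg`, then `b - g` is orthogonal
to `ran (B + iP)`, which is all of `H`. -/
lemma mem_domain_of_inner (g h : H) (hgh : ∀ x : B.domain, ⟪B x, g⟫_ℂ = ⟪(x : H), h⟫_ℂ) :
    ∃ y : B.domain, (y : H) = g ∧ B y = h := by
  obtain ⟨C, hC⟩ := hM.regular Complex.I (by simp)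
  obtain ⟨C', hC'⟩ := hM.regular (-Complex.I) (by simp)
  obtain ⟨b, hb⟩ := hC.surj (h - Complex.I • P g)
  have hbg : (b : H) = g := by
    obtain ⟨x, hx⟩ := hC'.surj (b - g)
    have h1 : ⟪B x + Complex.I • P x, (b : H) - g⟫_ℂ = 0 := by
      have e1 : B b = h - Complex.I • P g + Complex.I • P b := by rw [← hb]; abel
      rw [inner_sub_right, inner_add_left, inner_add_left, hgh x, hM.hermitian x b, e1,
        inner_smul_left, inner_smul_left, hM.inner_proj, hM.inner_proj]
      simp only [inner_add_right, inner_sub_right, inner_smul_right, Complex.conj_I]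
      ring
    have e2 : B x + Complex.I • P x = b - g := by
      rw [← hx]; simp
    rw [e2, inner_self_eq_zero, sub_eq_zero] at h1
    exact h1
  refine ⟨b, hbg, ?_⟩
  rw [hbg] at hb
  exact sub_left_injective hb

/-- If `y ⟂ dom B`, then `(0, y)` passes the test of `mem_domain_of_inner`, whence `y = B 0 = 0`. -/
lemma dense_domain : Dense (B.domain : Set H) := by
  rw [Submodule.dense_iff_topologicalClosure_eq_top,
    Submodule.topologicalClosure_eq_top_iff, Submodule.eq_bot_iff]
  intro y hy
  obtain ⟨b, hb0, hb⟩ := hM.mem_domain_of_inner 0 y fun x => by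
    rw [inner_zero_right, (Submodule.mem_orthogonal _ _).1 hy x x.2]
  obtain rfl : b = 0 := Subtype.ext hb0
  rw [← hb, LinearPMap.map_zero]

lemma isSelfAdjoint : IsSelfAdjoint B := by
  rw [LinearPMap.isSelfAdjoint_def]
  refine le_antisymm (show _ ∧ _ from ⟨fun g hg => ?_, fun x y hxy => ?_⟩)
    (LinearPMap.IsFormalAdjoint.le_adjoint hM.dense_domain hM.hermitian)
  · obtain ⟨y, hy, -⟩ := hM.mem_domain_of_inner g (B.adjoint ⟨g, hg⟩) fun x =>
      (LinearPMap.adjoint_isFormalAdjoint hM.dense_domain).symm x ⟨g, hg⟩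
    rw [← hy]
    exact y.2
  · refine LinearPMap.adjoint_apply_eq hM.dense_domain x fun v => ?_
    rw [hxy]
    exact hM.hermitian y v

lemma isClosed : B.IsClosed := hM.isSelfAdjoint.isClosed

lemma isClosed_restr : (restr B P W).IsClosed := by
  have h : ((restr B P W).graph : Set (H × H)) =
      (B.graph : Set (H × H)) ∩ ⋂ w ∈ W, {p | ⟪p.2 + Complex.I • P p.1, w⟫_ℂ = 0} := by
    ext p
    simp only [SetLike.mem_coe, mem_graph_restr_iff, Set.mem_inter_iff, Set.mem_iInter]
    rfl
  rw [LinearPMap.IsClosed, h]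
  exact hM.isClosed.inter (isClosed_biInter fun w _ => isClosed_eq (by fun_prop) (by fun_prop))

lemma isHermitian_restr : IsHermitian (restr B P W) := by
  intro x y
  obtain ⟨x', hx, hx', -⟩ := exists_of_mem_restr x
  obtain ⟨y', hy, hy', -⟩ := exists_of_mem_restr y
  rw [← hx, ← hx', ← hy, ← hy']
  exact hM.hermitian x' y'

/-! ### The decomposition `H₊ = dom B ∔ W` and the bi-extension. -/

/-- The condition `(B + iP)x ⟂ W` is tailored to give `⟪A x, w⟫ = ⟪x, i w⟫` for `w ∈ W`, so `W`
enters `dom A*`, with `A* w` the `H₀`-component of `i w`. -/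
lemma inner_restr_add (x : (restr B P W).domain) (b : B.domain) {w : H} (hw : w ∈ W) :
    ⟪restr B P W x, (b : H) + w⟫_ℂ = ⟪(x : H), B b + Complex.I • w⟫_ℂ := by
  obtain ⟨y, hy, hy', h⟩ := exists_of_mem_restr x
  rw [← hy', ← hy, inner_add_right, inner_add_right, hM.hermitian y b]
  congr 1
  have h1 := h w hw
  rw [inner_add_left, inner_smul_left, hM.inner_proj, hM.proj_eq w hw, Complex.conj_I] at h1
  rw [inner_smul_right]
  linear_combination h1

/-- `b + w` as an element of `H₊`. -/
lemma exists_plus (b : B.domain) {w : H} (hw : w ∈ W) :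
    ∃ f : Plus (restr B P W), Plus.incl _ f = b + w ∧
      Plus.adj _ f = (DomClosure (restr B P W)).orthogonalProjectionOnto (B b + Complex.I • w) :=
  Plus.exists_of_inner _ _ fun x => hM.inner_restr_add x b hw

/-- Choose `b` with `(B - iP)b = A* f - iPf`. Then `f - b` is orthogonal to `(B + iP) dom A = Wᗮ`,
hence lies in `Wᗮᗮ = W`, as `W` is finite-dimensional. -/
lemma exists_decomp (f : Plus (restr B P W)) :
    ∃ b : B.domain, ∃ w ∈ W, Plus.incl _ f = b + w := by
  have := hM.finite
  set g := Plus.incl _ f 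
  set h : H := (Plus.adj _ f : H)
  obtain ⟨C, hC⟩ := hM.regular Complex.I (by simp)
  obtain ⟨C', hC'⟩ := hM.regular (-Complex.I) (by simp)
  obtain ⟨b, hb⟩ := hC.surj (h - Complex.I • P g)
  refine ⟨b, g - b, ?_, by abel⟩
  rw [← W.orthogonal_orthogonal, Submodule.mem_orthogonal]
  intro k hk
  obtain ⟨x, hx⟩ := hC'.surj k
  have e2 : B x + Complex.I • P x = k := by rw [← hx]; simp
  have hxA : (x : H) ∈ (restr B P W).domain := by
    rw [mem_restr_iff, e2]
    exact (Submodule.mem_orthogonal' _ _).1 hk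
  have h3 := Plus.inner_apply_incl f ⟨x, hxA⟩
  rw [restr_apply] at h3
  have e1 : B b = h - Complex.I • P g + Complex.I • P b := by rw [← hb]; abel
  rw [← e2, inner_sub_right, inner_add_left, inner_add_left, hM.hermitian x b, e1, h3,
    inner_smul_left, inner_smul_left, hM.inner_proj, hM.inner_proj]
  simp only [inner_add_right, inner_sub_right, inner_smul_right, Complex.conj_I]
  ring

lemma decomp_unique {b b' : B.domain} {w w' : H} (hw : w ∈ W) (hw' : w' ∈ W)
    (h : (b : H) + w = b' + w') : b = b' ∧ w = w' := by
  have h1 : w - w' = b' - b := by rw [sub_eq_sub_iff_add_eq_add, add_comm w, h]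
  have h2 : w - w' = 0 := hM.disjoint _ (W.sub_mem hw hw') (h1 ▸ B.domain.sub_mem b'.2 b.2)
  refine ⟨Subtype.ext ?_, sub_eq_zero.1 h2⟩
  rw [h2] at h1
  exact (sub_eq_zero.1 h1.symm).symm

/-- The map `((b, Bb), w) ↦ b + w` is a bounded bijection from the Banach space `graph B × W` onto
`H₊`; the bounded inverse theorem makes `b + w ↦ Bb` and `b + w ↦ w` continuous in the norm of `H₊`.
-/
lemma exists_components : ∃ β ω : Plus (restr B P W) →L[ℂ] H,
    ∀ f, ω f ∈ W ∧ ∃ b : B.domain, Plus.incl _ f = b + ω f ∧ B b = β f := by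
  have := hM.finite
  have hcompl : CompleteSpace B.graph := hM.isClosed.completeSpace_coe
  have hcomplW : CompleteSpace W := FiniteDimensional.complete ℂ W
  have hex : ∀ p : B.graph × W, ∃ f : Plus (restr B P W),
      Plus.incl _ f = (p.1 : H × H).1 + p.2 ∧ Plus.adj _ f =
        (DomClosure (restr B P W)).orthogonalProjectionOnto
          ((p.1 : H × H).2 + Complex.I • (p.2 : H)) := by
    intro p
    obtain ⟨b, hb1, hb2⟩ := (LinearPMap.mem_graph_iff B).1 p.1.2
    rw [← hb1, ← hb2]
    exact hM.exists_plus b p.2.2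
  choose φ hφ1 hφ2 using hex
  let L : B.graph × W →ₗ[ℂ] Plus (restr B P W) :=
    { toFun := φ
      map_add' := fun p q => Plus.incl_injective (by
        rw [map_add, hφ1, hφ1, hφ1]
        simp only [Prod.fst_add, Prod.snd_add, Submodule.coe_add]
        abel)
      map_smul' := fun c p => Plus.incl_injective (by
        rw [map_smul, hφ1, hφ1]
        simp [smul_add]) }
  -- The element and its image under `A*` are each bounded by `2‖p‖`, so the graph norm is at most
  -- `√8 ‖p‖ ≤ 4‖p‖`.
  let Φ : B.graph × W →L[ℂ] Plus (restr B P W) := L.mkContinuous 4 fun p => by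
    have h1 : ‖(p.1 : H × H).1‖ ≤ ‖p‖ := (norm_fst_le (p.1 : H × H)).trans (norm_fst_le p)
    have h2 : ‖(p.1 : H × H).2‖ ≤ ‖p‖ := (norm_snd_le (p.1 : H × H)).trans (norm_fst_le p)
    have h3 : ‖(p.2 : H)‖ ≤ ‖p‖ := norm_snd_le p
    have h4 : ‖Plus.incl _ (φ p)‖ ≤ 2 * ‖p‖ := by
      rw [hφ1]
      linarith [norm_add_le (p.1 : H × H).1 (p.2 : H)]
    have h5 : ‖Plus.adj _ (φ p)‖ ≤ 2 * ‖p‖ := by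
      rw [hφ2]
      refine (Submodule.norm_orthogonalProjectionOnto_apply_le _ _).trans ?_
      refine (norm_add_le _ _).trans ?_
      rw [norm_smul, Complex.norm_I, one_mul]
      linarith
    have h6 := Plus.norm_sq _ (φ p)
    change ‖φ p‖ ≤ _
    rw [← sq_le_sq₀ (norm_nonneg _) (by positivity), h6]
    have h7 := (sq_le_sq₀ (norm_nonneg _) (by positivity)).2 h4
    have h8 := (sq_le_sq₀ (norm_nonneg _) (by positivity)).2 h5
    nlinarith [sq_nonneg ‖p‖]
  have hΦ : ∀ p, Plus.incl _ (Φ p) = (p.1 : H × H).1 + p.2 := hφ1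
  have hinj : LinearMap.ker Φ.toLinearMap = ⊥ := by
    rw [LinearMap.ker_eq_bot']
    rintro ⟨⟨p, hp⟩, w⟩ h0
    have h1 := hΦ (⟨p, hp⟩, w)
    have h0' : Φ (⟨p, hp⟩, w) = 0 := h0
    rw [h0', map_zero] at h1
    obtain ⟨b, hb1, hb2⟩ := (LinearPMap.mem_graph_iff B).1 hp
    obtain ⟨h2, h3⟩ := hM.decomp_unique (b := 0) (b' := b) W.zero_mem w.2
      (by rw [hb1]; simpa using h1)
    refine Prod.ext (Subtype.ext (Prod.ext ?_ ?_)) (Subtype.ext h3.symm)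
    · exact hb1.symm.trans (by rw [← h2]; rfl)
    · exact hb2.symm.trans (by rw [← h2, LinearPMap.map_zero]; rfl)
  have hsurj : LinearMap.range Φ.toLinearMap = ⊤ := by
    rw [LinearMap.range_eq_top]
    intro f
    obtain ⟨b, w, hw, h⟩ := hM.exists_decomp f
    exact ⟨(⟨(b, B b), B.mem_graph b⟩, ⟨w, hw⟩),
      Plus.incl_injective ((hΦ _).trans h.symm)⟩
  let e := ContinuousLinearEquiv.ofBijective Φ hinj hsurj
  refine ⟨ContinuousLinearMap.snd ℂ H H ∘L B.graph.subtypeL ∘L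
      ContinuousLinearMap.fst ℂ B.graph W ∘L e.symm.toContinuousLinearMap,
    W.subtypeL ∘L ContinuousLinearMap.snd ℂ B.graph W ∘L e.symm.toContinuousLinearMap,
    fun f => ⟨(e.symm f).2.2, ?_⟩⟩
  obtain ⟨b, hb1, hb2⟩ := (LinearPMap.mem_graph_iff B).1 (e.symm f).1.2
  refine ⟨b, ?_, hb2⟩
  have h1 := hΦ (e.symm f)
  rw [ContinuousLinearEquiv.ofBijective_apply_symm_apply Φ hinj hsurj f, ← hb1] at h1
  exact h1

/-- The operator `H₊ → H₋` with `(D (b + w), b' + w') = (B b, b' + w') + (w, B b')`. -/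
lemma exists_form : ∃ D : Plus (restr B P W) →L[ℂ] Minus (restr B P W),
    ∀ (f g : Plus (restr B P W)) (b b' : B.domain), ∀ w ∈ W, ∀ w' ∈ W,
      Plus.incl _ f = b + w → Plus.incl _ g = b' + w' →
      D f g = ⟪(b' : H) + w', B b⟫_ℂ + ⟪B b', w⟫_ℂ := by
  obtain ⟨β, ω, hβω⟩ := hM.exists_components
  let ι := Plus.inclL (restr B P W)
  -- `D = R⁻¹(ι*β + β*ω)`: the two terms produce the two summands of the form.
  refine ⟨(rieszInv (restr B P W)).toContinuousLinearEquiv.toContinuousLinearMap ∘L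
    (ContinuousLinearMap.adjoint ι ∘L β + ContinuousLinearMap.adjoint β ∘L ω), ?_⟩
  intro f g b b' w hw w' hw' hf hg
  have h1 : ∀ f : Plus (restr B P W), ∀ b : B.domain, ∀ w ∈ W, Plus.incl _ f = b + w →
      β f = B b ∧ ω f = w := by
    intro f b w hw hf
    obtain ⟨hω, b₁, hb₁, hβ⟩ := hβω f
    obtain ⟨rfl, h⟩ := hM.decomp_unique hw hω (hf.symm.trans hb₁)
    exact ⟨hβ.symm, h.symm⟩
  obtain ⟨hf1, hf2⟩ := h1 f b w hw hf
  obtain ⟨hg1, hg2⟩ := h1 g b' w' hw' hg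
  change ⟪g, ContinuousLinearMap.adjoint ι (β f) + ContinuousLinearMap.adjoint β (ω f)⟫_ℂ = _
  rw [inner_add_right, ContinuousLinearMap.adjoint_inner_right,
    ContinuousLinearMap.adjoint_inner_right, hf1, hf2, hg1]
  rw [← hg]
  rfl

/-- The bi-extension of `restr B P W` determined by `B`. -/
def biExt : Plus (restr B P W) →L[ℂ] Minus (restr B P W) := hM.exists_form.choose

lemma biExt_apply {f g : Plus (restr B P W)} {b b' : B.domain} {w w' : H} (hw : w ∈ W)
    (hw' : w' ∈ W) (hf : Plus.incl _ f = b + w) (hg : Plus.incl _ g = b' + w') :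
    hM.biExt f g = ⟪(b' : H) + w', B b⟫_ℂ + ⟪B b', w⟫_ℂ :=
  hM.exists_form.choose_spec f g b b' w hw w' hw' hf hg

lemma exists_plus_of_domain (b : B.domain) :
    ∃ f : Plus (restr B P W), Plus.incl _ f = b ∧
      Plus.adj _ f = (DomClosure (restr B P W)).orthogonalProjectionOnto (B b) := by
  simpa using hM.exists_plus b W.zero_mem

lemma biExt_of_domain {f : Plus (restr B P W)} {b : B.domain} (hf : Plus.incl _ f = b) :
    hM.biExt f = toMinus _ (B b) := by
  ext g
  obtain ⟨b', w', hw', hg⟩ := hM.exists_decomp g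
  rw [hM.biExt_apply W.zero_mem hw' (by rw [hf, add_zero]) hg, inner_zero_right, add_zero,
    toMinus_apply, hg]

lemma biExt_symm (f g : Plus (restr B P W)) : conj (hM.biExt f g) = hM.biExt g f := by
  obtain ⟨b, w, hw, hf⟩ := hM.exists_decomp f
  obtain ⟨b', w', hw', hg⟩ := hM.exists_decomp g
  rw [hM.biExt_apply hw hw' hf hg, hM.biExt_apply hw' hw hg hf, map_add, inner_conj_symm,
    inner_conj_symm, inner_add_right, inner_add_left, hM.hermitian b b']
  ring

lemma adjPM_biExt : adjPM hM.biExt = hM.biExt := by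
  ext g f
  rw [adjPM_apply, biExt_symm]

lemma biExt_apply_domain (f : Plus (restr B P W)) {g : Plus (restr B P W)} {b : B.domain}
    (hg : Plus.incl _ g = b) : hM.biExt f g = ⟪B b, Plus.incl _ f⟫_ℂ := by
  rw [← biExt_symm, hM.biExt_of_domain hg, toMinus_apply, inner_conj_symm]

/-- Testing `D f = y` on `dom B` says `⟪B x, f⟫ = ⟪x, y⟫`, and self-adjointness of `B` applies.
Hence the part of `D` in `H` is no larger than `B`. -/
lemma mem_domain_of_biExt {f : Plus (restr B P W)} {y : H} (h : hM.biExt f = toMinus _ y) :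
    ∃ b : B.domain, (b : H) = Plus.incl _ f ∧ B b = y := by
  refine hM.mem_domain_of_inner _ _ fun x => ?_
  obtain ⟨g, hg, -⟩ := hM.exists_plus_of_domain x
  rw [← hM.biExt_apply_domain f hg, h, toMinus_apply, hg]

lemma extends_biExt : Extends hM.biExt := by
  intro x
  obtain ⟨b, hb, hb', -⟩ := exists_of_mem_restr x
  obtain ⟨f, hf, -⟩ := hM.exists_plus_of_domain b
  exact ⟨f, hf.trans hb, by rw [hM.biExt_of_domain hf, hb']⟩

lemma isSelfAdjointBiExtension : IsSelfAdjointBiExtension hM.biExt where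
  extends_left := hM.extends_biExt
  extends_right := by rw [adjPM_biExt]; exact hM.extends_biExt
  selfAdjoint := hM.adjPM_biExt
  selfAdjoint_part := by
    refine ⟨B, fun x y => ?_, hM.isSelfAdjoint, restr_le B P W⟩
    rw [LinearPMap.mem_graph_iff]
    constructor
    · rintro ⟨b, h1, h2⟩
      obtain ⟨f, hf, -⟩ := hM.exists_plus_of_domain b
      exact ⟨f, hf.trans h1, by rw [hM.biExt_of_domain hf, h2]⟩
    · rintro ⟨f, h1, h2⟩
      obtain ⟨b, hb, hb'⟩ := hM.mem_domain_of_biExt h2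
      exact ⟨b, hb.trans h1, hb'⟩

/-! ### The projection in `H₊` -/

/-- Since `W ⊂ ran P`, the condition `(B + iP)x ⟂ W` is preserved by `P`. So `P` leaves `dom A` and
`H₀` invariant and commutes with `A`, and therefore with `A*`. -/
lemma exists_projPlus (f : Plus (restr B P W)) : ∃ g : Plus (restr B P W),
    Plus.incl _ g = P (Plus.incl _ f) ∧ (Plus.adj _ g : H) = P (Plus.adj _ f : H) := by
  have hcomm : ∀ x : (restr B P W).domain, ∃ y : (restr B P W).domain,
      (y : H) = P x ∧ restr B P W y = P (restr B P W x) := by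
    intro x
    obtain ⟨b, hb, hb', hbw⟩ := exists_of_mem_restr x
    obtain ⟨b', h1, h2⟩ := hM.comm b
    have hmem : (b' : H) ∈ (restr B P W).domain := by
      rw [mem_restr_iff]
      intro w hw
      rw [h1, h2, ← map_smul, ← map_add, hM.inner_proj, hM.proj_eq w hw, hbw w hw]
    refine ⟨⟨b', hmem⟩, by rw [← hb]; exact h1, ?_⟩
    rw [restr_apply, h2, hb']
  have hclos : P (Plus.adj _ f : H) ∈ DomClosure (restr B P W) := by
    have hmap : Set.MapsTo P (restr B P W).domain (restr B P W).domain := by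
      intro x hx
      obtain ⟨y, hy, -⟩ := hcomm ⟨x, hx⟩
      rw [← hy]
      exact y.2
    exact (hmap.closure P.continuous) (Plus.adj _ f).2
  obtain ⟨g, hg1, hg2⟩ := Plus.exists_of_inner (A := restr B P W) (P (Plus.incl _ f))
    (P (Plus.adj _ f : H)) fun x => by
      obtain ⟨y, hy1, hy2⟩ := hcomm x
      rw [← hM.inner_proj, ← hy2, Plus.inner_apply_incl, hy1, hM.inner_proj]
  refine ⟨g, hg1, ?_⟩
  rw [hg2]
  exact Submodule.starProjection_eq_self_iff.2 hclos

lemma exists_projPlusL : ∃ F : Plus (restr B P W) →L[ℂ] Plus (restr B P W), ∀ f,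
    Plus.incl _ (F f) = P (Plus.incl _ f) ∧ (Plus.adj _ (F f) : H) = P (Plus.adj _ f : H) := by
  choose φ hφ1 hφ2 using hM.exists_projPlus
  let L : Plus (restr B P W) →ₗ[ℂ] Plus (restr B P W) :=
    { toFun := φ
      map_add' := fun f g => Plus.incl_injective (by rw [hφ1, map_add, map_add, map_add, hφ1, hφ1])
      map_smul' := fun c f => Plus.incl_injective (by
        rw [hφ1, map_smul, map_smul, map_smul, hφ1]; rfl) }
  refine ⟨L.mkContinuous 1 fun f => ?_, fun f => ⟨hφ1 f, hφ2 f⟩⟩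
  change ‖φ f‖ ≤ _
  rw [one_mul, ← sq_le_sq₀ (norm_nonneg _) (norm_nonneg _), Plus.norm_sq, Plus.norm_sq, hφ1]
  have h : ‖Plus.adj _ (φ f)‖ ≤ ‖Plus.adj _ f‖ := by
    rw [Submodule.coe_norm, Submodule.coe_norm, hφ2]
    exact hM.norm_proj_le _
  gcongr
  exact hM.norm_proj_le _

/-- The restriction of `P` to `H₊`. -/
def projPlus : Plus (restr B P W) →L[ℂ] Plus (restr B P W) := hM.exists_projPlusL.choose

lemma incl_projPlus (f : Plus (restr B P W)) :
    Plus.incl _ (hM.projPlus f) = P (Plus.incl _ f) :=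
  (hM.exists_projPlusL.choose_spec f).1

lemma adj_projPlus (f : Plus (restr B P W)) :
    (Plus.adj _ (hM.projPlus f) : H) = P (Plus.adj _ f : H) :=
  (hM.exists_projPlusL.choose_spec f).2

lemma inner_projPlus (f g : Plus (restr B P W)) :
    ⟪hM.projPlus f, g⟫_ℂ = ⟪f, hM.projPlus g⟫_ℂ := by
  rw [Plus.inner_def, Plus.inner_def, Submodule.coe_inner, Submodule.coe_inner, adj_projPlus,
    adj_projPlus, incl_projPlus, incl_projPlus, hM.inner_proj, hM.inner_proj]

lemma isOrthogonalProjection_projPlus : IsOrthogonalProjection hM.projPlus := by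
  refine ⟨⟨?_, ?_⟩, P, hM.proj, hM.incl_projPlus⟩
  · ext f
    apply Plus.incl_injective
    change Plus.incl _ (hM.projPlus (hM.projPlus f)) = _
    rw [incl_projPlus, incl_projPlus, hM.proj_proj]
  · rw [ContinuousLinearMap.isSelfAdjoint_iff_isSymmetric]
    exact hM.inner_projPlus

lemma minusOp_projPlus_apply (φ : Minus (restr B P W)) (u : Plus (restr B P W)) :
    minusOp hM.projPlus φ u = φ (hM.projPlus u) := by
  change ⟪u, hM.projPlus (riesz _ φ)⟫_ℂ = _
  rw [← inner_projPlus, inner_riesz]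

/-- As forms, the two sides have `P` acting on the second or on the first argument. It replaces `b`
by `P b` and fixes `w`, and `PB = BP` together with `P w = w` makes the results agree. -/
lemma minusOp_comp_biExt : minusOp hM.projPlus ∘L hM.biExt = hM.biExt ∘L hM.projPlus := by
  ext f u
  change minusOp hM.projPlus (hM.biExt f) u = hM.biExt (hM.projPlus f) u
  obtain ⟨b, w, hw, hf⟩ := hM.exists_decomp f
  obtain ⟨b', w', hw', hu⟩ := hM.exists_decomp u
  obtain ⟨c, hc, hc'⟩ := hM.comm b
  obtain ⟨c', hd, hd'⟩ := hM.comm b'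
  rw [minusOp_projPlus_apply,
    hM.biExt_apply hw hw' hf (b' := c')
      (by rw [incl_projPlus, hu, map_add, hM.proj_eq w' hw', hd]),
    hM.biExt_apply hw hw' (b := c) (by rw [incl_projPlus, hf, map_add, hM.proj_eq w hw, hc]) hu,
    hc', hd', hd, hM.inner_proj, hM.proj_eq w hw, ← hM.inner_proj, map_add, hM.proj_eq w' hw']

/-! ### The resolvent of the pencil and the set `ρ(D, F, K)`. -/

lemma pencil_apply (z : ℂ) (f : Plus (restr B P W)) :
    pencil hM.biExt hM.projPlus z f = hM.biExt f - z • toMinus _ (P (Plus.incl _ f)) := by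
  rw [← hM.incl_projPlus]
  rfl

lemma pencil_of_domain (z : ℂ) {f : Plus (restr B P W)} {b : B.domain} (hf : Plus.incl _ f = b) :
    pencil hM.biExt hM.projPlus z f = toMinus _ (B b - z • P b) := by
  rw [pencil_apply, hM.biExt_of_domain hf, hf, map_sub, map_smul]

lemma mem_domain_of_pencil {z : ℂ} {f : Plus (restr B P W)} {y : H}
    (h : pencil hM.biExt hM.projPlus z f = toMinus _ y) :
    ∃ b : B.domain, (b : H) = Plus.incl _ f ∧ B b - z • P b = y := by
  rw [pencil_apply, sub_eq_iff_eq_add, ← map_smul, ← map_add] at h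
  obtain ⟨b, hb, hb'⟩ := hM.mem_domain_of_biExt h
  exact ⟨b, hb, by rw [hb', hb]; abel⟩

lemma pencil_apply_domain (z : ℂ) (f : Plus (restr B P W)) {u : Plus (restr B P W)} {b : B.domain}
    (hu : Plus.incl _ u = b) :
    pencil hM.biExt hM.projPlus z f u = ⟪B b - conj z • P b, Plus.incl _ f⟫_ℂ := by
  rw [pencil_apply, sub_apply, smul_apply,
    hM.biExt_apply_domain f hu, toMinus_apply, hu, inner_sub_left, inner_smul_left, hM.inner_proj,
    Complex.conj_conj, smul_eq_mul]

/-- The norm of `H` is dominated by the norm of `(D - z F) f` in `H₋` if `conj z` is regular. -/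
lemma norm_incl_le_pencil {z : ℂ} {C : ℝ} (hC : 0 ≤ C) (h : IsRegularPoint B P (conj z) C)
    (f : Plus (restr B P W)) :
    ‖Plus.incl _ f‖ ≤ (C + (1 + ‖z‖ * C)) * ‖pencil hM.biExt hM.projPlus z f‖ := by
  -- Test against `u = (B - z̄P)⁻¹ f`: the pairing of `(D - zF)f` with `u` is `‖f‖²`. The constant
  -- comes from `‖u‖₊ ≤ ‖b‖ + ‖Bb‖` and `Bb = f + z̄Pb`.
  obtain ⟨b, hb⟩ := h.surj (Plus.incl _ f)
  obtain ⟨u, hu, hu'⟩ := hM.exists_plus_of_domain b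
  have h1 := hM.pencil_apply_domain z f hu
  rw [hb] at h1
  set x := Plus.incl _ f
  have hbx : ‖(b : H)‖ ≤ C * ‖x‖ := by
    have := h.bound b
    rwa [hb] at this
  have hBb : ‖B b‖ ≤ (1 + ‖z‖ * C) * ‖x‖ := by
    have e : B b = x + conj z • P b := by rw [← hb]; abel
    rw [e]
    refine (norm_add_le _ _).trans ?_
    rw [norm_smul, RCLike.norm_conj, add_mul, one_mul, mul_assoc]
    gcongr
    exact (hM.norm_proj_le _).trans hbx
  have hun : ‖u‖ ≤ (C + (1 + ‖z‖ * C)) * ‖x‖ := by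
    have h3 : ‖u‖ ≤ ‖(b : H)‖ + ‖B b‖ := by
      rw [← sq_le_sq₀ (norm_nonneg _) (by positivity), Plus.norm_sq, hu, hu']
      have h4 := Submodule.norm_orthogonalProjectionOnto_apply_le
        (DomClosure (restr B P W)) (B b)
      have h5 := (sq_le_sq₀ (norm_nonneg _) (norm_nonneg _)).2 h4
      nlinarith [mul_nonneg (norm_nonneg (b : H)) (norm_nonneg (B b))]
    linarith
  by_cases hx : x = 0
  · rw [hx, norm_zero]
    positivity
  have h6 : ‖x‖ * ‖x‖ ≤ ((C + (1 + ‖z‖ * C)) * ‖pencil hM.biExt hM.projPlus z f‖) * ‖x‖ := by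
    calc ‖x‖ * ‖x‖ = ‖⟪x, x⟫_ℂ‖ := by
          rw [← inner_self_re_eq_norm, inner_self_eq_norm_mul_norm]
      _ = ‖pencil hM.biExt hM.projPlus z f u‖ := by rw [h1]
      _ ≤ ‖pencil hM.biExt hM.projPlus z f‖ * ‖u‖ := ContinuousLinearMap.le_opNorm _ _
      _ ≤ ‖pencil hM.biExt hM.projPlus z f‖ * ((C + (1 + ‖z‖ * C)) * ‖x‖) := by gcongr
      _ = _ := by ring
  exact le_of_mul_le_mul_right h6 (norm_pos_iff.2 hx)

variable {E : Type*} [NormedAddCommGroup E] [InnerProductSpace ℂ E] [FiniteDimensional ℂ E]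

/-- The input operator `K e = (D - i F) (ν e)`. -/
def inputOp (ν : E →ₗ[ℂ] Plus (restr B P W)) : E →L[ℂ] Minus (restr B P W) :=
  LinearMap.toContinuousLinearMap (pencil hM.biExt hM.projPlus Complex.I ∘ₗ ν)

lemma inputOp_apply (ν : E →ₗ[ℂ] Plus (restr B P W)) (e : E) :
    hM.inputOp ν e = pencil hM.biExt hM.projPlus Complex.I (ν e) := rfl

lemma inputOp_injective {ν : E →ₗ[ℂ] Plus (restr B P W)} (hν : Function.Injective ν) :
    Function.Injective (hM.inputOp ν) := by
  rw [injective_iff_map_eq_zero]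
  intro e he
  rw [inputOp_apply, ← map_zero (toMinus _)] at he
  obtain ⟨b, hb, hb'⟩ := hM.mem_domain_of_pencil he
  obtain ⟨C, hC⟩ := hM.regular Complex.I (by simp)
  have h := hC.bound b
  rw [hb', norm_zero, mul_zero, norm_le_zero_iff, hb] at h
  exact (map_eq_zero_iff ν hν).1 (Plus.incl_injective (h.trans (map_zero _).symm))

/-- `(D - z F)⁻¹ K e = ν e + (z - i) r` with `(B - z P) r = P (ν e)`. -/
lemma pencil_solution (ν : E →ₗ[ℂ] Plus (restr B P W)) (e : E) {z : ℂ} {r : B.domain}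
    (hr : B r - z • P r = P (Plus.incl _ (ν e))) {f : Plus (restr B P W)}
    (hf : Plus.incl _ f = r) :
    pencil hM.biExt hM.projPlus z (ν e + (z - Complex.I) • f) = hM.inputOp ν e := by
  -- `(D - zF) ν e` equals `K e - (z - i) P ν e`, and the term with `f` cancels the defect.
  rw [map_add, map_smul, hM.pencil_of_domain z hf, hr, inputOp_apply, pencil_apply, pencil_apply]
  ext u
  simp only [add_apply, sub_apply, smul_apply, smul_eq_mul]
  ring

/-- Existence needs `z`: `H` is reached from `dom B`, and `ran K` by `pencil_solution`. Uniqueness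
and continuity need `conj z`, through `norm_incl_le_pencil`. -/
lemma mem_rho (ν : E →ₗ[ℂ] Plus (restr B P W)) {z : ℂ} {C C' : ℝ} (h : IsRegularPoint B P z C)
    (hC' : 0 ≤ C') (h' : IsRegularPoint B P (conj z) C') :
    z ∈ rho hM.biExt hM.projPlus (hM.inputOp ν) := by
  refine ⟨fun y hy => ?_, _, fun f _ => hM.norm_incl_le_pencil hC' h' f⟩
  obtain ⟨_, ⟨k, rfl⟩, _, ⟨e, rfl⟩, rfl⟩ := Submodule.mem_sup.1 hy
  obtain ⟨b, hb⟩ := h.surj k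
  obtain ⟨r, hr⟩ := h.surj (P (Plus.incl _ (ν e)))
  obtain ⟨g, hg, -⟩ := hM.exists_plus_of_domain b
  obtain ⟨f, hf, -⟩ := hM.exists_plus_of_domain r
  refine ⟨g + (ν e + (z - Complex.I) • f), ?_, fun f' hf' => ?_⟩
  · change pencil _ _ _ _ = _
    rw [map_add, hM.pencil_of_domain z hg, hb, hM.pencil_solution ν e hr hf]
    rfl
  · have h1 : pencil hM.biExt hM.projPlus z (f' - (g + (ν e + (z - Complex.I) • f))) = 0 := by
      rw [map_sub, hf', map_add, hM.pencil_of_domain z hg, hb, hM.pencil_solution ν e hr hf]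
      exact sub_self _
    have h2 := hM.norm_incl_le_pencil hC' h' (f' - (g + (ν e + (z - Complex.I) • f)))
    have h3 : ‖(0 : Minus (restr B P W))‖ = 0 := ContinuousLinearMap.opNorm_zero
    rw [h1] at h2
    rw [h3, mul_zero, norm_le_zero_iff] at h2
    exact sub_eq_zero.1 (Plus.incl_injective (h2.trans (map_zero _).symm))

lemma regular_of_mem_rho (ν : E →ₗ[ℂ] Plus (restr B P W)) {z : ℂ}
    (h : z ∈ rho hM.biExt hM.projPlus (hM.inputOp ν)) : ∃ C, 0 < C ∧ IsRegularPoint B P z C := by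
  obtain ⟨h1, C, h2⟩ := h
  refine ⟨max C 1, by positivity, fun k => ?_, fun x => ?_⟩
  · obtain ⟨f, hf, -⟩ := h1 (toMinus _ k) (Submodule.mem_sup_left ⟨k, rfl⟩)
    obtain ⟨b, -, hb⟩ := hM.mem_domain_of_pencil hf
    exact ⟨b, hb⟩
  · obtain ⟨f, hf, -⟩ := hM.exists_plus_of_domain x
    have h3 := hM.pencil_of_domain z hf
    have h4 := h2 f (h3 ▸ Submodule.mem_sup_left ⟨_, rfl⟩)
    rw [hf, h3] at h4
    refine h4.trans ?_
    gcongr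
    · exact le_max_left _ _
    · exact norm_toMinus_le _

lemma mem_rho_of_im_ne_zero (ν : E →ₗ[ℂ] Plus (restr B P W)) {z : ℂ} (hz : z.im ≠ 0) :
    z ∈ rho hM.biExt hM.projPlus (hM.inputOp ν) := by
  obtain ⟨C, h⟩ := hM.regular z hz
  obtain ⟨C', h'⟩ := hM.regular (conj z) (by simpa using hz)
  exact hM.mem_rho ν h (le_max_right C' 0) (h'.mono (le_max_left C' 0))

/-- Only real `z₀` requires an argument: a disc about `z₀` is invariant under conjugation, so
stability of regular points covers both `z` and `conj z`, as `mem_rho` demands. -/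
lemma isOpen_rho (ν : E →ₗ[ℂ] Plus (restr B P W)) :
    IsOpen (rho hM.biExt hM.projPlus (hM.inputOp ν)) := by
  rw [isOpen_iff_mem_nhds]
  intro z₀ hz₀
  by_cases him : z₀.im = 0
  · obtain ⟨C, hC, h⟩ := hM.regular_of_mem_rho ν hz₀
    refine Metric.mem_nhds_iff.2 ⟨1 / C, by positivity, fun z hz => ?_⟩
    rw [mem_ball_iff_norm, lt_div_iff₀ hC, mul_comm] at hz
    have hz' : C * ‖conj z - z₀‖ < 1 := by
      have : conj z - z₀ = conj (z - z₀) := by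
        rw [map_sub, Complex.conj_eq_iff_im.2 him]
      rwa [this, RCLike.norm_conj]
    exact hM.mem_rho ν (h.perturb hM.norm_proj_le hC hz)
      (div_nonneg hC.le (by linarith)) (h.perturb hM.norm_proj_le hC hz')
  · exact Filter.mem_of_superset ((isOpen_ne_fun Complex.continuous_im continuous_const).mem_nhds
      him) fun z hz => hM.mem_rho_of_im_ne_zero ν hz

lemma isImpedanceSystem {ν : E →ₗ[ℂ] Plus (restr B P W)} (hν : Function.Injective ν) :
    IsImpedanceSystem (restr B P W) hM.biExt hM.projPlus (hM.inputOp ν) where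
  isClosed := hM.isClosed_restr
  isHermitian := hM.isHermitian_restr
  biExtension := hM.isSelfAdjointBiExtension
  injective := hM.inputOp_injective hν
  projection := hM.isOrthogonalProjection_projPlus
  isOpen_rho := hM.isOpen_rho ν

/-- Realization by a pencil model: if `n e = b e + w e` and a function `V` satisfies the two
identities below, then `V` is the transfer function of the associated system. -/
theorem realization [CompleteSpace E] (V : ℂ → E →L[ℂ] E) (b : E →ₗ[ℂ] B.domain) (w : E →ₗ[ℂ] W)
    (hinj : ∀ e, (b e : H) + w e = 0 → e = 0)
    (hVI : ∀ φ e, ⟪V Complex.I φ, e⟫_ℂ = ⟪(b φ : H) + w φ, B (b e)⟫_ℂ + ⟪B (b φ), (w e : H)⟫_ℂ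
      - Complex.I * ⟪(b φ : H) + w φ, P (b e + w e)⟫_ℂ)
    (hV : ∀ z : ℂ, z.im ≠ 0 → ∀ φ, ∃ r : B.domain, B r - z • P r = P (b φ + w φ) ∧
      ∀ e, ⟪V z φ, e⟫_ℂ = ⟪V Complex.I φ, e⟫_ℂ +
        conj (z - Complex.I) * ⟪B r + Complex.I • P r, b e + w e⟫_ℂ) :
    ∃ (A : H →ₗ.[ℂ] H) (D : Plus A →L[ℂ] Minus A) (F : Plus A →L[ℂ] Plus A) (K : E →L[ℂ] Minus A),
      IsImpedanceSystem A D F K ∧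
      (∀ z : ℂ, z.im ≠ 0 → z ∈ rho D F K ∧
        ∀ φ : E, ∃ f : Plus A, pencil D F z f = K φ ∧ V z φ = adjK K f) ∧
      minusOp F ∘L D = D ∘L F := by
  choose ν hν using fun e => hM.exists_plus (b e) (w e).2
  let N : E →ₗ[ℂ] Plus (restr B P W) :=
    { toFun := ν
      map_add' := fun x y => Plus.incl_injective (by
        rw [map_add, (hν _).1, (hν _).1, (hν _).1, map_add, map_add, Submodule.coe_add,
          Submodule.coe_add]
        abel)
      map_smul' := fun c x => Plus.incl_injective (by
        rw [map_smul, (hν _).1, (hν _).1, map_smul, map_smul, Submodule.coe_smul,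
          Submodule.coe_smul, smul_add]
        rfl) }
  have hN : ∀ e, Plus.incl _ (N e) = b e + w e := fun e => (hν e).1
  have hNinj : Function.Injective N := by
    rw [injective_iff_map_eq_zero]
    intro e he
    apply hinj
    rw [← hN, he, map_zero]
  refine ⟨restr B P W, hM.biExt, hM.projPlus, hM.inputOp N, hM.isImpedanceSystem hNinj,
    fun z hz => ⟨hM.mem_rho_of_im_ne_zero N hz, fun φ => ?_⟩, hM.minusOp_comp_biExt⟩
  obtain ⟨r, hr, hre⟩ := hV z hz φ
  obtain ⟨f, hf, -⟩ := hM.exists_plus_of_domain r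
  refine ⟨N φ + (z - Complex.I) • f, hM.pencil_solution N φ (by rw [hN]; exact hr) hf, ?_⟩
  refine ext_inner_right ℂ fun e => ?_
  -- `K*(ν φ)` is `V(i) φ` by `hVI`; on the domain vector `r`, the pencil at `i` transposes to `⟪(B
  -- + iP) r, ν e⟫`.
  rw [hre, inner_adjK, map_add, map_smulₛₗ, inputOp_apply, hM.pencil_apply_domain _ _ hf, hN,
    pencil_apply, sub_apply, smul_apply, hM.biExt_apply (w e).2 (w φ).2 (hN e) (hN φ),
    toMinus_apply, hN, hN, hVI]
  simp

end IsPencilModel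

/-! ### Direct sum of a bounded invertible operator and a self-adjoint operator -/

section DirectSum

variable {H₀ H₁ : Type*} [NormedAddCommGroup H₀] [InnerProductSpace ℂ H₀]
  [NormedAddCommGroup H₁] [InnerProductSpace ℂ H₁]

/-- `B₁ - z` is bounded below if `B₁` is symmetric and `z` is not real. -/
lemma IsHermitian.norm_le {B : H₁ →ₗ.[ℂ] H₁} (hB : IsHermitian B) (z : ℂ) (x : B.domain) :
    |z.im| * ‖(x : H₁)‖ ≤ ‖B x - z • (x : H₁)‖ := by
  by_cases hx : (x : H₁) = 0
  · rw [hx, norm_zero, mul_zero]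
    exact norm_nonneg _
  have h1 : (⟪(x : H₁), B x⟫_ℂ).im = 0 := by
    rw [← Complex.conj_eq_iff_im, inner_conj_symm]
    exact hB x x
  have h2 : (⟪(x : H₁), B x - z • (x : H₁)⟫_ℂ).im = -(z.im * (‖(x : H₁)‖ * ‖(x : H₁)‖)) := by
    rw [inner_sub_right, inner_smul_right, inner_self_eq_norm_sq_to_K, Complex.sub_im, h1]
    simp [pow_two]
  have h3 : |z.im| * ‖(x : H₁)‖ * ‖(x : H₁)‖ ≤ ‖B x - z • (x : H₁)‖ * ‖(x : H₁)‖ := by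
    calc |z.im| * ‖(x : H₁)‖ * ‖(x : H₁)‖ = |(⟪(x : H₁), B x - z • (x : H₁)⟫_ℂ).im| := by
          rw [h2, abs_neg, abs_mul, abs_of_nonneg (mul_nonneg (norm_nonneg _) (norm_nonneg _))]
          ring
      _ ≤ ‖⟪(x : H₁), B x - z • (x : H₁)⟫_ℂ‖ := Complex.abs_im_le_norm _
      _ ≤ ‖(x : H₁)‖ * ‖B x - z • (x : H₁)‖ := norm_inner_le_norm _ _
      _ = _ := mul_comm _ _
  exact le_of_mul_le_mul_right h3 (norm_pos_iff.2 hx)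

/-- The operator `D₀ ⊕ B₁`. -/
def dirSum (D₀ : H₀ →ₗ[ℂ] H₀) (B₁ : H₁ →ₗ.[ℂ] H₁) :
    WithLp 2 (H₀ × H₁) →ₗ.[ℂ] WithLp 2 (H₀ × H₁) where
  domain :=
    { carrier := {x | x.snd ∈ B₁.domain}
      add_mem' := fun hx hy => B₁.domain.add_mem hx hy
      zero_mem' := B₁.domain.zero_mem
      smul_mem' := fun c _ hx => B₁.domain.smul_mem c hx }
  toFun :=
    { toFun := fun x => WithLp.toLp 2 (D₀ (x : WithLp 2 (H₀ × H₁)).fst, B₁ ⟨_, x.2⟩)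
      map_add' := fun x y => by
        rw [← WithLp.toLp_add, Prod.mk_add_mk, ← map_add, ← LinearPMap.map_add]
        rfl
      map_smul' := fun c x => by
        rw [RingHom.id_apply, ← WithLp.toLp_smul, Prod.smul_mk, ← map_smul, ← LinearPMap.map_smul]
        rfl }

/-- The orthogonal projection onto the second summand. -/
def sndProj (H₀ H₁ : Type*) [NormedAddCommGroup H₀] [InnerProductSpace ℂ H₀]
    [NormedAddCommGroup H₁] [InnerProductSpace ℂ H₁] :
    WithLp 2 (H₀ × H₁) →L[ℂ] WithLp 2 (H₀ × H₁) :=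
  (WithLp.prodContinuousLinearEquiv 2 ℂ H₀ H₁).symm.toContinuousLinearMap ∘L
    ContinuousLinearMap.inr ℂ H₀ H₁ ∘L ContinuousLinearMap.snd ℂ H₀ H₁ ∘L
    (WithLp.prodContinuousLinearEquiv 2 ℂ H₀ H₁).toContinuousLinearMap

lemma sndProj_apply (x : WithLp 2 (H₀ × H₁)) : sndProj H₀ H₁ x = WithLp.toLp 2 (0, x.snd) := rfl

/-- The second summand. -/
def sndIncl (H₀ H₁ : Type*) [NormedAddCommGroup H₀] [InnerProductSpace ℂ H₀]
    [NormedAddCommGroup H₁] [InnerProductSpace ℂ H₁] : H₁ →ₗ[ℂ] WithLp 2 (H₀ × H₁) :=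
  (WithLp.linearEquiv 2 ℂ (H₀ × H₁)).symm.toLinearMap ∘ₗ LinearMap.inr ℂ H₀ H₁

/-- `(x, y)` as an element of the domain of `D₀ ⊕ B₁`. -/
def dirSumMk (D₀ : H₀ →ₗ[ℂ] H₀) (B₁ : H₁ →ₗ.[ℂ] H₁) (x : H₀) (y : B₁.domain) :
    (dirSum D₀ B₁).domain :=
  ⟨WithLp.toLp 2 (x, (y : H₁)), y.2⟩

lemma coe_dirSumMk (D₀ : H₀ →ₗ[ℂ] H₀) (B₁ : H₁ →ₗ.[ℂ] H₁) (x : H₀) (y : B₁.domain) :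
    (dirSumMk D₀ B₁ x y : WithLp 2 (H₀ × H₁)) = WithLp.toLp 2 (x, (y : H₁)) := rfl

lemma dirSum_dirSumMk (D₀ : H₀ →ₗ[ℂ] H₀) (B₁ : H₁ →ₗ.[ℂ] H₁) (x : H₀) (y : B₁.domain) :
    dirSum D₀ B₁ (dirSumMk D₀ B₁ x y) = WithLp.toLp 2 (D₀ x, B₁ y) := rfl

lemma exists_dirSumMk {D₀ : H₀ →ₗ[ℂ] H₀} {B₁ : H₁ →ₗ.[ℂ] H₁} (u : (dirSum D₀ B₁).domain) :
    ∃ x y, u = dirSumMk D₀ B₁ x y := ⟨(u : WithLp 2 (H₀ × H₁)).fst, ⟨_, u.2⟩, rfl⟩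

lemma dirSum_sub_smul_sndProj (D₀ : H₀ →ₗ[ℂ] H₀) (B₁ : H₁ →ₗ.[ℂ] H₁) (x : H₀) (y : B₁.domain)
    (z : ℂ) : dirSum D₀ B₁ (dirSumMk D₀ B₁ x y) - z • sndProj H₀ H₁ (dirSumMk D₀ B₁ x y) =
      WithLp.toLp 2 (D₀ x, B₁ y - z • (y : H₁)) := by
  rw [dirSum_dirSumMk, sndProj_apply, coe_dirSumMk, ← WithLp.toLp_smul, ← WithLp.toLp_sub,
    Prod.smul_mk, Prod.mk_sub_mk, smul_zero, sub_zero]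
  rfl

/-- `P` vanishes on the first summand, so the pencil is `D₀ ⊕ (B₁ - z)`: its first part is
invertible independently of `z`, and the inverse of the second is bounded by `1/|Im z|`. -/
lemma isPencilModel_dirSum [CompleteSpace H₀] [CompleteSpace H₁] {D₀ : H₀ →ₗ[ℂ] H₀}
    (hD₀ : D₀.IsSymmetric) (hsurj : Function.Surjective D₀) {C₀ : ℝ} (hC₀ : ∀ x, ‖x‖ ≤ C₀ * ‖D₀ x‖)
    {B₁ : H₁ →ₗ.[ℂ] H₁} (hB₁ : IsHermitian B₁)
    (hB₁' : ∀ z : ℂ, z.im ≠ 0 → ∀ h, ∃ x : B₁.domain, B₁ x - z • (x : H₁) = h)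
    {W : Submodule ℂ H₁} (hW : FiniteDimensional ℂ W) (hWB : ∀ w ∈ W, w ∈ B₁.domain → w = 0) :
    IsPencilModel (dirSum D₀ B₁) (sndProj H₀ H₁) (W.map (sndIncl H₀ H₁)) where
  hermitian u v := by
    obtain ⟨x, y, rfl⟩ := exists_dirSumMk u
    obtain ⟨x', y', rfl⟩ := exists_dirSumMk v
    simp only [dirSum_dirSumMk, coe_dirSumMk, WithLp.prod_inner_apply]
    rw [hD₀ x x', hB₁ y y']
  proj := by
    refine ⟨by ext x; rfl, ?_⟩
    rw [ContinuousLinearMap.isSelfAdjoint_iff_isSymmetric]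
    intro x y
    simp [sndProj_apply, WithLp.prod_inner_apply]
  comm u := by
    obtain ⟨x, y, rfl⟩ := exists_dirSumMk u
    refine ⟨dirSumMk D₀ B₁ 0 y, rfl, ?_⟩
    rw [dirSum_dirSumMk, map_zero]
    rfl
  regular z hz := by
    refine ⟨max C₀ 0 + |z.im|⁻¹, fun h => ?_, fun u => ?_⟩
    · obtain ⟨x, hx⟩ := hsurj h.fst
      obtain ⟨y, hy⟩ := hB₁' z hz h.snd
      refine ⟨dirSumMk D₀ B₁ x y, ?_⟩
      rw [dirSum_sub_smul_sndProj, hx, hy]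
      rfl
    · obtain ⟨x, y, rfl⟩ := exists_dirSumMk u
      have h1 : ‖x‖ ≤ max C₀ 0 * ‖D₀ x‖ :=
        (hC₀ x).trans (mul_le_mul_of_nonneg_right (le_max_left _ _) (norm_nonneg _))
      have h2 : ‖(y : H₁)‖ ≤ |z.im|⁻¹ * ‖B₁ y - z • (y : H₁)‖ := by
        rw [← div_eq_inv_mul, le_div_iff₀ (abs_pos.2 hz), mul_comm]
        exact hB₁.norm_le z y
      rw [dirSum_sub_smul_sndProj, coe_dirSumMk]
      set v : WithLp 2 (H₀ × H₁) := WithLp.toLp 2 (D₀ x, B₁ y - z • (y : H₁)) with hv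
      have hv2 := WithLp.prod_norm_sq_eq_of_L2 v
      have h3 : ‖D₀ x‖ ≤ ‖v‖ := by
        rw [← sq_le_sq₀ (norm_nonneg _) (norm_nonneg _), hv2]
        exact le_add_of_nonneg_right (sq_nonneg _)
      have h4 : ‖B₁ y - z • (y : H₁)‖ ≤ ‖v‖ := by
        rw [← sq_le_sq₀ (norm_nonneg _) (norm_nonneg _), hv2]
        exact le_add_of_nonneg_left (sq_nonneg _)
      have h5 : ‖(WithLp.toLp 2 (x, (y : H₁)) : WithLp 2 (H₀ × H₁))‖ ≤ ‖x‖ + ‖(y : H₁)‖ := by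
        rw [← sq_le_sq₀ (norm_nonneg _) (by positivity), WithLp.prod_norm_sq_eq_of_L2]
        change ‖x‖ ^ 2 + ‖(y : H₁)‖ ^ 2 ≤ _
        nlinarith [mul_nonneg (norm_nonneg x) (norm_nonneg (y : H₁))]
      refine h5.trans ?_
      rw [add_mul]
      refine add_le_add (h1.trans ?_) (h2.trans ?_) <;> gcongr
  proj_eq := by
    rintro _ ⟨w, -, rfl⟩
    rfl
  disjoint := by
    rintro _ ⟨w, hw, rfl⟩ hwB
    rw [hWB w hw hwB, map_zero]
  finite := by
    infer_instance

end DirectSum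

/-! ### Realization with an arbitrary self-adjoint constant term -/

section Block

variable {E : Type*} [NormedAddCommGroup E] [InnerProductSpace ℂ E]

/-- The block operator `[[0, 1], [1, -Q]]`, whose inverse is `[[Q, 1], [1, 0]]`. -/
def blockOp (Q : E →L[ℂ] E) : WithLp 2 (E × E) →ₗ[ℂ] WithLp 2 (E × E) where
  toFun x := WithLp.toLp 2 (x.snd, x.fst - Q x.snd)
  map_add' x y := by
    rw [← WithLp.toLp_add (p := 2) (V := E × E) (x.snd, _) (y.snd, _), Prod.mk_add_mk,
      WithLp.add_fst, WithLp.add_snd, map_add, add_sub_add_comm]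
  map_smul' c x := by
    rw [RingHom.id_apply, ← WithLp.toLp_smul (p := 2) (V := E × E) c (x.snd, _), Prod.smul_mk,
      WithLp.smul_fst, WithLp.smul_snd, map_smul, smul_sub]

lemma blockOp_apply (Q : E →L[ℂ] E) (x : WithLp 2 (E × E)) :
    blockOp Q x = WithLp.toLp 2 (x.snd, x.fst - Q x.snd) := rfl

lemma blockOp_isSymmetric [CompleteSpace E] {Q : E →L[ℂ] E} (hQ : IsSelfAdjoint Q) :
    (blockOp Q).IsSymmetric := by
  intro x y
  have h : ⟪Q x.snd, y.snd⟫_ℂ = ⟪x.snd, Q y.snd⟫_ℂ :=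
    (ContinuousLinearMap.isSelfAdjoint_iff_isSymmetric.1 hQ) _ _
  simp only [blockOp_apply, WithLp.prod_inner_apply, inner_sub_left, inner_sub_right]
  change ⟪x.snd, y.fst⟫_ℂ + (⟪x.fst, y.snd⟫_ℂ - ⟪Q x.snd, y.snd⟫_ℂ)
    = ⟪x.fst, y.snd⟫_ℂ + (⟪x.snd, y.fst⟫_ℂ - ⟪x.snd, Q y.snd⟫_ℂ)
  rw [h]
  ring

/-- For `z = 0` the vector `(Qy, y)` has image `(y, 0)`. Pairing such a vector with such an image
yields `⟪Qφ, e⟫`, the constant term to be realized. -/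
lemma blockOp_solve (Q : E →L[ℂ] E) (y z : E) :
    blockOp Q (WithLp.toLp 2 (Q y + z, y)) = WithLp.toLp 2 (y, z) := by
  rw [blockOp_apply]
  simp

lemma blockOp_surjective (Q : E →L[ℂ] E) : Function.Surjective (blockOp Q) :=
  fun y => ⟨_, blockOp_solve Q y.fst y.snd⟩

lemma blockOp_injective (Q : E →L[ℂ] E) : Function.Injective (blockOp Q) := by
  rw [injective_iff_map_eq_zero]
  intro x hx
  rw [blockOp_apply] at hx
  have h1 : x.snd = 0 := congrArg (fun v : WithLp 2 (E × E) => v.fst) hx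
  have h2 : x.fst - Q x.snd = 0 := congrArg (fun v : WithLp 2 (E × E) => v.snd) hx
  rw [h1, map_zero, sub_zero] at h2
  exact WithLp.ofLp_injective 2 (Prod.ext h2 h1)

lemma blockOp_bound [FiniteDimensional ℂ E] (Q : E →L[ℂ] E) :
    ∃ C : ℝ, ∀ x, ‖x‖ ≤ C * ‖blockOp Q x‖ := by
  let e := LinearEquiv.ofBijective (blockOp Q) ⟨blockOp_injective Q, blockOp_surjective Q⟩
  let G := LinearMap.toContinuousLinearMap e.symm.toLinearMap
  refine ⟨‖G‖, fun x => ?_⟩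
  have h : G (blockOp Q x) = x := e.symm_apply_apply x
  nth_rewrite 1 [← h]
  exact G.le_opNorm _

end Block

/-- A function `V` of the form `V(i) + (z - i) n* (B + i) (B - z)⁻¹ n`, with `B` self-adjoint and
`V(i)* = V(-i)`, is the transfer function of an impedance system. -/
theorem exists_impedanceSystem {E : Type u} [NormedAddCommGroup E] [InnerProductSpace ℂ E]
    [CompleteSpace E] [FiniteDimensional ℂ E] (V : ℂ → E →L[ℂ] E)
    (hVadj : ContinuousLinearMap.adjoint (V Complex.I) = V (-Complex.I))
    {H₁ : Type u} [NormedAddCommGroup H₁] [InnerProductSpace ℂ H₁] [CompleteSpace H₁]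
    {B₁ : H₁ →ₗ.[ℂ] H₁} (hB₁ : IsHermitian B₁)
    (hB₁' : ∀ z : ℂ, z.im ≠ 0 → ∀ h, ∃ x : B₁.domain, B₁ x - z • (x : H₁) = h)
    (n : E →ₗ[ℂ] H₁)
    (hV : ∀ z : ℂ, z.im ≠ 0 → ∀ φ, ∃ r : B₁.domain, B₁ r - z • (r : H₁) = n φ ∧
      ∀ e, ⟪V z φ, e⟫_ℂ = ⟪V Complex.I φ, e⟫_ℂ +
        conj (z - Complex.I) * ⟪B₁ r + Complex.I • (r : H₁), n e⟫_ℂ) :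
    ∃ (H : Type u) (_ : NormedAddCommGroup H) (_ : InnerProductSpace ℂ H) (_ : CompleteSpace H)
      (A : H →ₗ.[ℂ] H) (D : Plus A →L[ℂ] Minus A)
      (F : Plus A →L[ℂ] Plus A) (K : E →L[ℂ] Minus A),
      IsImpedanceSystem A D F K ∧
      (∀ z : ℂ, z.im ≠ 0 → z ∈ rho D F K ∧
        ∀ φ : E, ∃ f : Plus A, pencil D F z f = K φ ∧ V z φ = adjK K f) ∧
      minusOp F ∘L D = D ∘L F := by
  -- Splitting `E = M ⊕ Mᗮ` gives `n = b₁ + w₁` with `b₁` valued in `dom B₁`, and `n(Mᗮ)` meets `dom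
  -- B₁` only in `0` since `M ∩ Mᗮ = 0`.
  let M : Submodule ℂ E := B₁.domain.comap n
  let W₁ : Submodule ℂ H₁ := Mᗮ.map n
  have hWB : ∀ w ∈ W₁, w ∈ B₁.domain → w = 0 := by
    rintro _ ⟨m, hm, rfl⟩ hmB
    have h0 : m ∈ M ⊓ Mᗮ := ⟨hmB, hm⟩
    rw [Submodule.inf_orthogonal_eq_bot, Submodule.mem_bot] at h0
    rw [h0, map_zero]
  let b₁ : E →ₗ[ℂ] B₁.domain := (n ∘ₗ M.starProjection.toLinearMap).codRestrict B₁.domain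
    fun e => M.starProjection_apply_mem e
  let w₁ : E →ₗ[ℂ] W₁ := (n ∘ₗ Mᗮ.starProjection.toLinearMap).codRestrict W₁
    fun e => ⟨_, Mᗮ.starProjection_apply_mem e, rfl⟩
  have hn : ∀ e, (b₁ e : H₁) + w₁ e = n e := by
    intro e
    change n (M.starProjection e) + n (Mᗮ.starProjection e) = n e
    rw [← map_add, Submodule.starProjection_add_starProjection_orthogonal]
  let βc : E →L[ℂ] H₁ := LinearMap.toContinuousLinearMap (B₁.toFun ∘ₗ b₁)
  let ωc : E →L[ℂ] H₁ := LinearMap.toContinuousLinearMap (W₁.subtype ∘ₗ w₁)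
  let nc : E →L[ℂ] H₁ := LinearMap.toContinuousLinearMap n
  have hβ : ∀ e, βc e = B₁ (b₁ e) := fun _ => rfl
  have hω : ∀ e, ωc e = w₁ e := fun _ => rfl
  have hnc : ∀ e, nc e = n e := fun _ => rfl
  -- The discrepancy between `V(i)` and what the summand `H₁` alone contributes to `K* ν`.
  let Q : E →L[ℂ] E := V Complex.I
    - (ContinuousLinearMap.adjoint βc ∘L nc + ContinuousLinearMap.adjoint ωc ∘L βc)
    - Complex.I • (ContinuousLinearMap.adjoint nc ∘L nc)
  have hQ : ∀ φ e, ⟪Q φ, e⟫_ℂ = ⟪V Complex.I φ, e⟫_ℂ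
      - (⟪n φ, B₁ (b₁ e)⟫_ℂ + ⟪B₁ (b₁ φ), (w₁ e : H₁)⟫_ℂ) + Complex.I * ⟪n φ, n e⟫_ℂ := by
    intro φ e
    simp only [Q, sub_apply, add_apply, smul_apply,
      ContinuousLinearMap.comp_apply, inner_sub_left, inner_add_left, inner_smul_left,
      ContinuousLinearMap.adjoint_inner_left, hβ, hω, hnc, Complex.conj_I]
    ring
  -- At `z = -i` the vector `(B₁ + i) r` is `n φ` itself, so `V(i) - V(-i) = 2i n*n`.
  have hVI' : ∀ φ e, ⟪V (-Complex.I) φ, e⟫_ℂ = ⟪V Complex.I φ, e⟫_ℂ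
      + 2 * Complex.I * ⟪n φ, n e⟫_ℂ := by
    intro φ e
    obtain ⟨r, hr, hre⟩ := hV (-Complex.I) (by simp) φ
    rw [hre, ← hr]
    simp only [neg_smul, sub_neg_eq_add, map_sub, map_neg, Complex.conj_I]
    ring
  -- As `V(i)* = V(-i)`, subtracting `i n*n` removes precisely the skew part of `V(i)`; the other
  -- subtracted form is Hermitian because `B₁` is.
  have hQsa : IsSelfAdjoint Q := by
    rw [ContinuousLinearMap.isSelfAdjoint_iff_isSymmetric]
    intro φ e
    change ⟪Q φ, e⟫_ℂ = ⟪φ, Q e⟫_ℂ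
    have h1 : ⟪V Complex.I e, φ⟫_ℂ = conj ⟪V Complex.I φ, e⟫_ℂ
        + conj (2 * Complex.I * ⟪n φ, n e⟫_ℂ) := by
      rw [← map_add, ← hVI', ← hVadj, ContinuousLinearMap.adjoint_inner_left, inner_conj_symm]
    rw [← inner_conj_symm φ (Q e), hQ, hQ, h1]
    simp only [map_add, map_sub, map_mul, inner_conj_symm, Complex.conj_I, map_neg, map_ofNat]
    rw [← hn φ, ← hn e]
    simp only [inner_add_left, inner_add_right, hB₁ (b₁ φ) (b₁ e)]
    ring
  obtain ⟨C₀, hC₀⟩ := blockOp_bound Q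
  have hM := isPencilModel_dirSum (blockOp_isSymmetric hQsa) (blockOp_surjective Q) hC₀ hB₁ hB₁'
    (W := W₁) inferInstance hWB
  -- The entry `Q e` produces the constant term, and the entry `e` makes the input operator
  -- injective even if `n` is not.
  let b : E →ₗ[ℂ] (dirSum (blockOp Q) B₁).domain :=
    { toFun := fun e => dirSumMk (blockOp Q) B₁ (WithLp.toLp 2 (Q e, e)) (b₁ e)
      map_add' := fun x y => by rw [map_add, map_add]; rfl
      map_smul' := fun c x => by rw [map_smul, map_smul]; rfl }
  let w : E →ₗ[ℂ] W₁.map (sndIncl (WithLp 2 (E × E)) H₁) :=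
    (sndIncl (WithLp 2 (E × E)) H₁ ∘ₗ W₁.subtype ∘ₗ w₁).codRestrict _
      fun e => ⟨_, (w₁ e).2, rfl⟩
  have hb : ∀ e, (b e : WithLp 2 (WithLp 2 (E × E) × H₁))
      = WithLp.toLp 2 (WithLp.toLp 2 (Q e, e), (b₁ e : H₁)) := fun _ => rfl
  have hBb : ∀ e, dirSum (blockOp Q) B₁ (b e) = WithLp.toLp 2 (WithLp.toLp 2 (e, 0), B₁ (b₁ e)) := by
    intro e
    have := blockOp_solve Q e 0
    rw [add_zero] at this
    rw [← this]
    rfl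
  have hw : ∀ e, (w e : WithLp 2 (WithLp 2 (E × E) × H₁)) = WithLp.toLp 2 (0, (w₁ e : H₁)) :=
    fun _ => rfl
  have hbw : ∀ e, (b e : WithLp 2 (WithLp 2 (E × E) × H₁)) + w e
      = WithLp.toLp 2 (WithLp.toLp 2 (Q e, e), n e) := by
    intro e
    rw [hb, hw, ← WithLp.toLp_add, Prod.mk_add_mk, add_zero, hn]
  refine ⟨WithLp 2 (WithLp 2 (E × E) × H₁), inferInstance, inferInstance, inferInstance,
    hM.realization V b w ?_ ?_ ?_⟩
  · intro e he
    rw [hbw] at he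
    exact congrArg (fun v : WithLp 2 (WithLp 2 (E × E) × H₁) => v.fst.snd) he
  · intro φ e
    rw [hbw, hbw, hBb, hBb, hw, sndProj_apply]
    simp only [WithLp.prod_inner_apply, WithLp.toLp_snd, inner_zero_right, hQ,
      zero_add, add_zero]
    ring
  · intro z hz φ
    obtain ⟨r, hr, hre⟩ := hV z hz φ
    -- `P` kills the `E ⊕ E` component of the right-hand side, so that of the solution is `0` and
    -- the dependence on `z` is that of `H₁`.
    refine ⟨dirSumMk (blockOp Q) B₁ 0 r, ?_, fun e => ?_⟩
    · rw [hbw, dirSum_sub_smul_sndProj, map_zero, hr]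
      rfl
    · have h := dirSum_sub_smul_sndProj (blockOp Q) B₁ 0 r (-Complex.I)
      rw [neg_smul, neg_smul, sub_neg_eq_add, sub_neg_eq_add, map_zero] at h
      rw [hre, hbw, h, WithLp.prod_inner_apply, inner_zero_left, zero_add]

end Rigged

/-! ### The density of an operator-valued Stieltjes measure -/

section Density

open MeasureTheory Filter Topology
open scoped NNReal ENNReal

variable {E : Type*} [NormedAddCommGroup E] [InnerProductSpace ℂ E]

lemma quadraticMeasure_Ioc {S : ℝ → E →L[ℂ] E} (hS : Monotone S) (x : E) (a b : ℝ) :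
    quadraticMeasure S hS x (Set.Ioc a b) =
      ENNReal.ofReal ((monotone_quadraticForm hS x).stieltjesFunction b
        - (monotone_quadraticForm hS x).stieltjesFunction a) :=
  StieltjesFunction.measure_Ioc _ _ _

lemma tendsto_quadraticForm {S : ℝ → E →L[ℂ] E} (hS : Monotone S) (x : E) (a : ℝ) :
    Tendsto (fun ε : ℝ => (⟪x, S (a + ε) x⟫_ℂ).re) (𝓝[>] 0)
      (𝓝 ((monotone_quadraticForm hS x).stieltjesFunction a)) := by
  have h := (monotone_quadraticForm hS x).tendsto_rightLim a
  refine h.comp (tendsto_nhdsWithin_iff.2 ⟨?_, ?_⟩)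
  · have : Tendsto (fun ε : ℝ => a + ε) (𝓝 0) (𝓝 (a + 0)) :=
      tendsto_const_nhds.add tendsto_id
    rw [add_zero] at this
    exact this.mono_left nhdsWithin_le_nhds
  · filter_upwards [self_mem_nhdsWithin] with ε hε
    simpa using hε

/-- Linear relations between quadratic forms of positive operators pass to the Stieltjes
functions. -/
lemma sum_stieltjesFunction_sub {S : ℝ → E →L[ℂ] E} (hS : Monotone S) {ι : Type*} [Fintype ι]
    (c : ι → ℝ) (y : ι → E)
    (hc : ∀ T : E →L[ℂ] E, T.IsPositive → ∑ k, c k * (⟪y k, T (y k)⟫_ℂ).re = 0) {a b : ℝ}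
    (hab : a ≤ b) :
    ∑ k, c k * ((monotone_quadraticForm hS (y k)).stieltjesFunction b
      - (monotone_quadraticForm hS (y k)).stieltjesFunction a) = 0 := by
  have h1 : Tendsto (fun ε : ℝ => ∑ k, c k * ((⟪y k, S (b + ε) (y k)⟫_ℂ).re
      - (⟪y k, S (a + ε) (y k)⟫_ℂ).re)) (𝓝[>] 0)
      (𝓝 (∑ k, c k * ((monotone_quadraticForm hS (y k)).stieltjesFunction b
      - (monotone_quadraticForm hS (y k)).stieltjesFunction a))) :=
    tendsto_finsetSum _ fun k _ => ((tendsto_quadraticForm hS (y k) b).sub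
      (tendsto_quadraticForm hS (y k) a)).const_mul (c k)
  refine tendsto_nhds_unique h1 (tendsto_const_nhds.congr fun ε => ?_)
  have hpos := (ContinuousLinearMap.le_def _ _).1 (hS (show a + ε ≤ b + ε by linarith))
  rw [← hc _ hpos]
  simp only [sub_apply, inner_sub_right, Complex.sub_re]

/-- The relation holds for the increments of `S`, which are positive operators, hence on half-open
intervals. Coefficients are split into positive and negative parts because measures cannot be
subtracted. -/
lemma sum_quadraticMeasure_eq {S : ℝ → E →L[ℂ] E} (hS : Monotone S) {ι : Type*} [Fintype ι]
    (c : ι → ℝ) (y : ι → E)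
    (hc : ∀ T : E →L[ℂ] E, T.IsPositive → ∑ k, c k * (⟪y k, T (y k)⟫_ℂ).re = 0) :
    Measure.sum (fun k => (c k).toNNReal • quadraticMeasure S hS (y k)) =
      Measure.sum (fun k => (-c k).toNNReal • quadraticMeasure S hS (y k)) := by
  have key : ∀ (d : ι → ℝ) (a b : ℝ), a ≤ b →
      Measure.sum (fun k => (d k).toNNReal • quadraticMeasure S hS (y k)) (Set.Ioc a b) =
      ENNReal.ofReal (∑ k, (d k).toNNReal * ((monotone_quadraticForm hS (y k)).stieltjesFunction b
        - (monotone_quadraticForm hS (y k)).stieltjesFunction a)) := by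
    intro d a b hab
    rw [Measure.sum_apply _ measurableSet_Ioc, tsum_fintype, ENNReal.ofReal_sum_of_nonneg]
    · refine Finset.sum_congr rfl fun k _ => ?_
      rw [Measure.smul_apply, quadraticMeasure_Ioc, ENNReal.smul_def, smul_eq_mul,
        ENNReal.ofReal_mul (NNReal.coe_nonneg _), ENNReal.ofReal_coe_nnreal]
    · intro k _
      exact mul_nonneg (NNReal.coe_nonneg _)
        (sub_nonneg.2 ((monotone_quadraticForm hS (y k)).stieltjesFunction.mono hab))
  refine Measure.ext_of_Ioc' _ _ (fun a b hab => ?_) fun a b hab => ?_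
  · rw [key c a b hab.le]
    exact ENNReal.ofReal_ne_top
  · rw [key c a b hab.le, key (fun k => -c k) a b hab.le]
    congr 1
    rw [← sub_eq_zero, ← Finset.sum_sub_distrib]
    rw [← sum_stieltjesFunction_sub hS c y hc hab.le]
    refine Finset.sum_congr rfl fun k _ => ?_
    rw [← sub_mul, Real.coe_toNNReal', Real.coe_toNNReal', max_zero_sub_max_neg_zero_eq_self]

instance sigmaFinite_quadraticMeasure {S : ℝ → E →L[ℂ] E} (hS : Monotone S) (x : E) :
    SigmaFinite (quadraticMeasure S hS x) := by
  unfold quadraticMeasure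
  infer_instance

/-- The density of `(dΣ x, x)` with respect to `σ`. -/
def quadraticDensity (S : ℝ → E →L[ℂ] E) (hS : Monotone S) (σ : Measure ℝ) (x : E) (t : ℝ) : ℝ :=
  ((quadraticMeasure S hS x).rnDeriv σ t).toReal

lemma sum_quadraticDensity_ae {S : ℝ → E →L[ℂ] E} (hS : Monotone S) {σ : Measure ℝ}
    [SigmaFinite σ] (hσ : ∀ x, quadraticMeasure S hS x ≪ σ) {ι : Type*} [Fintype ι]
    (c : ι → ℝ) (y : ι → E)
    (hc : ∀ T : E →L[ℂ] E, T.IsPositive → ∑ k, c k * (⟪y k, T (y k)⟫_ℂ).re = 0) :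
    ∀ᵐ t ∂σ, ∑ k, c k * quadraticDensity S hS σ (y k) t = 0 := by
  have hm : ∀ (d : ι → ℝ) (k : ι), Measurable
      (((d k).toNNReal : ℝ≥0∞) • (quadraticMeasure S hS (y k)).rnDeriv σ) := fun d k =>
    (Measure.measurable_rnDeriv _ _).const_smul _
  have h1 : ∀ d : ι → ℝ, Measure.sum (fun k => (d k).toNNReal • quadraticMeasure S hS (y k)) =
      σ.withDensity (∑' k, ((d k).toNNReal : ℝ≥0∞) • (quadraticMeasure S hS (y k)).rnDeriv σ) := by
    intro d
    rw [withDensity_tsum (hm d)]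
    congr 1
    ext1 k
    rw [withDensity_smul _ (Measure.measurable_rnDeriv _ _),
      Measure.withDensity_rnDeriv_eq _ _ (hσ (y k))]
    rfl
  have h2 := sum_quadraticMeasure_eq hS c y hc
  rw [h1 c, h1 fun k => -c k, tsum_fintype, tsum_fintype, withDensity_eq_iff_of_sigmaFinite
    (Finset.aemeasurable_sum _ fun k _ => (hm c k).aemeasurable)
    (Finset.aemeasurable_sum _ fun k _ => (hm (fun k => -c k) k).aemeasurable)] at h2
  have h3 : ∀ᵐ t ∂σ, ∀ k, (quadraticMeasure S hS (y k)).rnDeriv σ t < ∞ :=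
    ae_all_iff.2 fun k => Measure.rnDeriv_lt_top _ _
  filter_upwards [h2, h3] with t ht hfin
  have h4 := congrArg ENNReal.toReal ht
  simp only [Finset.sum_apply, Pi.smul_apply, smul_eq_mul] at h4
  rw [ENNReal.toReal_sum fun k _ => ENNReal.mul_ne_top ENNReal.coe_ne_top (hfin k).ne,
    ENNReal.toReal_sum fun k _ => ENNReal.mul_ne_top ENNReal.coe_ne_top (hfin k).ne,
    ← sub_eq_zero, ← Finset.sum_sub_distrib] at h4
  rw [← h4]
  refine Finset.sum_congr rfl fun k _ => ?_
  rw [ENNReal.toReal_mul, ENNReal.toReal_mul, ← sub_mul, ENNReal.coe_toReal, ENNReal.coe_toReal,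
    Real.coe_toNNReal', Real.coe_toNNReal', max_zero_sub_max_neg_zero_eq_self]
  rfl

/-- An operator on a finite-dimensional space is determined linearly by finitely many values of its
quadratic form. -/
lemma exists_quadratic_reconstruction (E : Type*) [NormedAddCommGroup E] [InnerProductSpace ℂ E]
    [FiniteDimensional ℂ E] : ∃ (d : ℕ) (y : Fin d × Fin d × Fin 4 → E)
      (m : Fin d × Fin d × Fin 4 → E →L[ℂ] E),
      ∀ T : E →L[ℂ] E, T = ∑ k, ⟪y k, T (y k)⟫_ℂ • m k := by
  let b := stdOrthonormalBasis ℂ E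
  -- Polarization: `⟪bᵢ, T bⱼ⟫` is the sum over `k < 4` of `(-i)ᵏ/4` times the quadratic form of `T`
  -- at `bᵢ + iᵏ bⱼ`.
  refine ⟨Module.finrank ℂ E, fun k => b k.1 + Complex.I ^ (k.2.2 : ℕ) • b k.2.1,
    fun k => ((-Complex.I) ^ (k.2.2 : ℕ) / 4) • InnerProductSpace.rankOne ℂ (b k.1) (b k.2.1),
    fun T => ?_⟩
  have hpol : ∀ u v : E, ∑ k : Fin 4, (⟪u + Complex.I ^ (k : ℕ) • v,
      T (u + Complex.I ^ (k : ℕ) • v)⟫_ℂ * ((-Complex.I) ^ (k : ℕ) / 4)) = ⟪u, T v⟫_ℂ := by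
    intro u v
    have h2 : Complex.I ^ 2 = -1 := Complex.I_sq
    have h3 : Complex.I ^ 3 = -Complex.I := Complex.I_pow_three
    have h2' : (-Complex.I) ^ 2 = -1 := by rw [neg_sq, Complex.I_sq]
    have h3' : (-Complex.I) ^ 3 = Complex.I := by
      rw [neg_pow, Complex.I_pow_three]; ring
    simp only [Fin.sum_univ_four, Fin.val_zero, Fin.val_one, Fin.val_two, pow_zero, pow_one,
      show ((3 : Fin 4) : ℕ) = 3 from rfl, h2, h3, h2', h3', inner_add_left, inner_add_right,
      map_add, map_smul, inner_smul_left, inner_smul_right, map_neg, map_one, Complex.conj_I]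
    linear_combination (- ⟪u, T v⟫_ℂ / 2 + ⟪v, T u⟫_ℂ / 2 ) * Complex.I_sq
  ext v
  rw [← b.sum_repr' (T v)]
  rw [Fintype.sum_prod_type]
  simp only [Fintype.sum_prod_type, _root_.sum_apply, smul_smul]
  refine Finset.sum_congr rfl fun i _ => ?_
  have h1 : ∀ j, ∑ k : Fin 4, ((⟪b i + Complex.I ^ (k : ℕ) • b j,
      T (b i + Complex.I ^ (k : ℕ) • b j)⟫_ℂ * ((-Complex.I) ^ (k : ℕ) / 4)) •
        InnerProductSpace.rankOne ℂ (b i) (b j)) v = (⟪b i, T (b j)⟫_ℂ * ⟪b j, v⟫_ℂ) • b i := by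
    intro j
    rw [← hpol, Finset.sum_mul, Finset.sum_smul]
    refine Finset.sum_congr rfl fun k _ => ?_
    rw [smul_apply, InnerProductSpace.rankOne_apply, smul_smul]
  rw [Finset.sum_congr rfl fun j _ => h1 j, ← Finset.sum_smul]
  congr 1
  nth_rewrite 1 [← b.sum_repr' v]
  simp [map_sum, inner_sum, inner_smul_right, mul_comm]

lemma re_inner_reconstruction {ι : Type*} [Fintype ι] {y : ι → E} {m : ι → E →L[ℂ] E}
    (hm : ∀ T : E →L[ℂ] E, T = ∑ k, ⟪y k, T (y k)⟫_ℂ • m k) {T : E →L[ℂ] E} (hT : T.IsPositive)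
    (x : E) : ⟪x, T x⟫_ℂ = ∑ k, ((⟪y k, T (y k)⟫_ℂ).re : ℂ) * ⟪x, m k x⟫_ℂ := by
  nth_rewrite 1 [hm T]
  simp only [_root_.sum_apply, inner_sum, smul_apply, inner_smul_right]
  refine Finset.sum_congr rfl fun k _ => ?_
  congr 1
  exact (Complex.conj_eq_iff_re.1
    (by rw [inner_conj_symm]; exact hT.inner_left_eq_inner_right _ _)).symm

/-- By reconstruction `(T x, x)` is a real combination of the `(T yₖ, yₖ)` for positive `T`. In the
index `Option ι`, `none` carries `x` with coefficient `1`, which turns this into a relation for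
`sum_quadraticMeasure_eq`. -/
lemma quadraticMeasure_absolutelyContinuous {S : ℝ → E →L[ℂ] E} (hS : Monotone S) {ι : Type*}
    [Fintype ι] {y : ι → E} {m : ι → E →L[ℂ] E}
    (hm : ∀ T : E →L[ℂ] E, T = ∑ k, ⟪y k, T (y k)⟫_ℂ • m k) (x : E) :
    quadraticMeasure S hS x ≪ Measure.sum fun k => quadraticMeasure S hS (y k) := by
  have h := sum_quadraticMeasure_eq hS (ι := Option ι)
    (fun o => o.elim 1 fun k => -(⟪x, m k x⟫_ℂ).re) (fun o => o.elim x y) fun T hT => by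
      have h1 := congrArg Complex.re (re_inner_reconstruction hm hT x)
      simp only [Complex.re_sum, Complex.re_ofReal_mul] at h1
      rw [Fintype.sum_option]
      simp only [Option.elim_none, Option.elim_some, one_mul, h1]
      rw [← Finset.sum_add_distrib]
      exact Finset.sum_eq_zero fun k _ => by ring
  refine Measure.AbsolutelyContinuous.mk fun s hs h0 => ?_
  rw [Measure.sum_apply _ hs, ENNReal.tsum_eq_zero] at h0
  have h2 := congrArg (fun ν : Measure ℝ => ν s) h
  simp only [Measure.sum_apply _ hs, tsum_fintype, Fintype.sum_option, Option.elim_none,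
    Option.elim_some, Measure.smul_apply, h0, smul_zero, Finset.sum_const_zero, add_zero] at h2
  simpa [Real.toNNReal_of_nonpos] using h2

/-- The real and imaginary parts of the reconstruction formula are two real linear relations among
quadratic forms, and each passes to densities. The exceptional null set depends on `x`. -/
lemma quadraticDensity_eq_ae {S : ℝ → E →L[ℂ] E} (hS : Monotone S) {σ : Measure ℝ}
    [SigmaFinite σ] (hσ : ∀ x, quadraticMeasure S hS x ≪ σ) {ι : Type*}
    [Fintype ι] {y : ι → E} {m : ι → E →L[ℂ] E}
    (hm : ∀ T : E →L[ℂ] E, T = ∑ k, ⟪y k, T (y k)⟫_ℂ • m k) (x : E) :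
    ∀ᵐ t ∂σ, ⟪x, (∑ k, (quadraticDensity S hS σ (y k) t : ℂ) • m k) x⟫_ℂ =
      quadraticDensity S hS σ x t := by
  have hre := sum_quadraticDensity_ae hS hσ (ι := Option ι)
    (fun o => o.elim 1 fun k => -(⟪x, m k x⟫_ℂ).re) (fun o => o.elim x y) fun T hT => by
      have h1 := congrArg Complex.re (re_inner_reconstruction hm hT x)
      simp only [Complex.re_sum, Complex.re_ofReal_mul] at h1
      rw [Fintype.sum_option]
      simp only [Option.elim_none, Option.elim_some, one_mul, h1]
      rw [← Finset.sum_add_distrib]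
      exact Finset.sum_eq_zero fun k _ => by ring
  have him := sum_quadraticDensity_ae hS hσ (fun k => (⟪x, m k x⟫_ℂ).im) y fun T hT => by
      have h1 := congrArg Complex.im (re_inner_reconstruction hm hT x)
      simp only [Complex.im_sum, Complex.im_ofReal_mul] at h1
      have h2 : (⟪x, T x⟫_ℂ).im = 0 := Complex.conj_eq_iff_im.1
        (by rw [inner_conj_symm]; exact hT.inner_left_eq_inner_right _ _)
      rw [← h2, h1]
      exact Finset.sum_congr rfl fun k _ => mul_comm _ _
  filter_upwards [hre, him] with t h1 h2
  simp only [_root_.sum_apply, inner_sum, smul_apply, inner_smul_right]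
  rw [Fintype.sum_option] at h1
  simp only [Option.elim_none, Option.elim_some, one_mul] at h1
  apply Complex.ext
  · simp only [Complex.re_sum, Complex.re_ofReal_mul, Complex.ofReal_re]
    rw [eq_neg_of_add_eq_zero_left h1, ← Finset.sum_neg_distrib]
    exact Finset.sum_congr rfl fun k _ => by ring
  · simp only [Complex.im_sum, Complex.im_ofReal_mul, Complex.ofReal_im]
    rw [← h2]
    exact Finset.sum_congr rfl fun k _ => by ring

lemma isPositive_of_dense {T : E →L[ℂ] E} {s : Set E} (hs : Dense s)
    (h : ∀ x ∈ s, (⟪x, T x⟫_ℂ).im = 0 ∧ 0 ≤ (⟪x, T x⟫_ℂ).re) : T.IsPositive := by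
  have h1 : ∀ x, (⟪x, T x⟫_ℂ).im = 0 ∧ 0 ≤ (⟪x, T x⟫_ℂ).re := by
    have hc : IsClosed {x : E | (⟪x, T x⟫_ℂ).im = 0 ∧ 0 ≤ (⟪x, T x⟫_ℂ).re} :=
      (isClosed_eq (f := fun x : E => (⟪x, T x⟫_ℂ).im) (by fun_prop) continuous_const).inter
        (isClosed_le (g := fun x : E => (⟪x, T x⟫_ℂ).re) continuous_const (by fun_prop))
    intro x
    exact hc.closure_subset_iff.2 h (hs x)
  rw [ContinuousLinearMap.isPositive_iff_complex]
  intro x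
  rw [← inner_conj_symm]
  obtain ⟨h2, h3⟩ := h1 x
  rw [Complex.conj_eq_iff_im.2 h2]
  exact ⟨Complex.conj_eq_iff_re.1 (Complex.conj_eq_iff_im.2 h2), h3⟩

/-- The square root is continuous on the closed cone of nonnegative operators and is `0` by default
off it. -/
lemma measurable_cfc_sqrt [CompleteSpace E] :
    Measurable (CFC.sqrt : (E →L[ℂ] E) → E →L[ℂ] E) := by
  classical
  have h : (CFC.sqrt : (E →L[ℂ] E) → E →L[ℂ] E) =
      Set.piecewise {a | 0 ≤ a} CFC.sqrt (fun _ => 0) := by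
    ext1 a
    by_cases ha : a ∈ {a : E →L[ℂ] E | 0 ≤ a}
    · rw [Set.piecewise_eq_of_mem _ _ _ ha]
    · rw [Set.piecewise_eq_of_notMem _ _ _ ha, CFC.sqrt_of_not_nonneg ha]
  rw [h]
  exact ContinuousOn.measurable_piecewise CFC.continuousOn_sqrt continuousOn_const
    CStarAlgebra.isClosed_nonneg.measurableSet

/-- An operator-valued Stieltjes measure on a finite-dimensional space has the form `s(t)² dσ(t)`
with a scalar measure `σ` and a measurable function `s` with nonnegative values. -/
theorem exists_sqrt_density [FiniteDimensional ℂ E] [CompleteSpace E] {S : ℝ → E →L[ℂ] E}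
    (hS : Monotone S) : ∃ (σ : Measure ℝ) (s : ℝ → E →L[ℂ] E),
      (∀ e, StronglyMeasurable fun t => s t e) ∧
      ∀ (x : E) (g : ℝ → ℂ), Integrable g (quadraticMeasure S hS x) →
        Integrable (fun t => g t * ⟪s t x, s t x⟫_ℂ) σ ∧
        ∫ t, g t ∂(quadraticMeasure S hS x) = ∫ t, g t * ⟪s t x, s t x⟫_ℂ ∂σ := by
  obtain ⟨d, y, m, hm⟩ := exists_quadratic_reconstruction E
  let σ := Measure.sum fun k => quadraticMeasure S hS (y k)
  have hσ : ∀ x, quadraticMeasure S hS x ≪ σ := quadraticMeasure_absolutelyContinuous hS hm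
  let M : ℝ → E →L[ℂ] E := fun t => ∑ k, (quadraticDensity S hS σ (y k) t : ℂ) • m k
  have hMmeas : StronglyMeasurable M := by
    refine Finset.stronglyMeasurable_fun_sum _ fun k _ => ?_
    refine StronglyMeasurable.smul_const ?_ _
    exact (Complex.measurable_ofReal.comp
      (Measure.measurable_rnDeriv _ _).ennreal_toReal).stronglyMeasurable
  have hM := quadraticDensity_eq_ae hS hσ hm
  have : ProperSpace E := FiniteDimensional.proper ℂ E
  have : ProperSpace (E →L[ℂ] E) := FiniteDimensional.proper ℂ _
  -- A countable dense set of vectors reduces the null sets depending on `x` to a single one.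
  have hpos : ∀ᵐ t ∂σ, 0 ≤ M t := by
    have h := ae_all_iff.2 fun i : ℕ => hM (TopologicalSpace.denseSeq E i)
    filter_upwards [h] with t ht
    rw [ContinuousLinearMap.nonneg_iff_isPositive]
    refine isPositive_of_dense (TopologicalSpace.denseRange_denseSeq E) ?_
    rintro _ ⟨i, rfl⟩
    change (⟪_, (∑ k, (quadraticDensity S hS σ (y k) t : ℂ) • m k) _⟫_ℂ).im = 0 ∧
      0 ≤ (⟪_, (∑ k, (quadraticDensity S hS σ (y k) t : ℂ) • m k) _⟫_ℂ).re
    rw [ht i]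
    exact ⟨Complex.ofReal_im _, by rw [Complex.ofReal_re]; exact ENNReal.toReal_nonneg⟩
  refine ⟨σ, fun t => CFC.sqrt (M t), fun e => ?_, fun x g hg => ?_⟩
  · have h1 : StronglyMeasurable fun t => CFC.sqrt (M t) :=
      (measurable_cfc_sqrt.comp hMmeas.measurable).stronglyMeasurable
    exact (ContinuousLinearMap.apply ℂ E e).continuous.comp_stronglyMeasurable h1
  · have hae : (fun t => ((quadraticMeasure S hS x).rnDeriv σ t).toReal • g t) =ᵐ[σ]
        fun t => g t * ⟪CFC.sqrt (M t) x, CFC.sqrt (M t) x⟫_ℂ := by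
      filter_upwards [hM x, hpos] with t h1 h2
      have h3 : ⟪CFC.sqrt (M t) x, CFC.sqrt (M t) x⟫_ℂ = ⟪x, M t x⟫_ℂ := by
        have hp := (ContinuousLinearMap.nonneg_iff_isPositive _).1 (CFC.sqrt_nonneg (M t))
        rw [hp.inner_left_eq_inner_right]
        nth_rewrite 3 [← CFC.sqrt_mul_sqrt_self (M t) h2]
        rfl
      rw [h3]
      refine Eq.trans ?_ (congrArg (g t * ·) h1.symm)
      rw [Complex.real_smul, mul_comm]
      rfl
    rw [← integral_congr_ae hae, integral_rnDeriv_smul (hσ x)]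
    exact ⟨((integrable_rnDeriv_smul_iff (hσ x)).2 hg).congr hae, rfl⟩

end Density

/-! ### Multiplication by the independent variable -/

section MulOp

open MeasureTheory

variable {E : Type*} [NormedAddCommGroup E] [InnerProductSpace ℂ E]

/-- Multiplication by `t` in `L²(σ; E)`, on its maximal domain. -/
def mulOp (E : Type*) [NormedAddCommGroup E] [InnerProductSpace ℂ E] (σ : Measure ℝ) :
    Lp E 2 σ →ₗ.[ℂ] Lp E 2 σ where
  domain :=
    { carrier := {f | MemLp (fun t : ℝ => (t : ℂ) • f t) 2 σ}
      add_mem' := fun {f g} hf hg => (hf.add hg).ae_eq (by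
        filter_upwards [Lp.coeFn_add f g] with t ht
        rw [ht]
        simp only [Pi.add_apply, smul_add])
      zero_mem' := by
        refine MemLp.ae_eq ?_ (MemLp.zero (ε := E) (p := 2) (μ := σ))
        filter_upwards [Lp.coeFn_zero E 2 σ] with t ht
        rw [ht]
        simp
      smul_mem' := fun c f hf => (hf.const_smul c).ae_eq (by
        filter_upwards [Lp.coeFn_smul c f] with t ht
        rw [ht]
        simp only [Pi.smul_apply, smul_comm c]) }
  toFun :=
    { toFun := fun f => MemLp.toLp _ f.2
      map_add' := fun f g => by
        rw [← MemLp.toLp_add, MemLp.toLp_eq_toLp_iff]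
        filter_upwards [Lp.coeFn_add (f : Lp E 2 σ) g] with t ht
        change (t : ℂ) • (((f : Lp E 2 σ) + g : Lp E 2 σ) : ℝ → E) t = _
        rw [ht]
        simp only [Pi.add_apply, smul_add]
      map_smul' := fun c f => by
        rw [RingHom.id_apply, ← MemLp.toLp_const_smul, MemLp.toLp_eq_toLp_iff]
        filter_upwards [Lp.coeFn_smul c (f : Lp E 2 σ)] with t ht
        change (t : ℂ) • ((c • (f : Lp E 2 σ) : Lp E 2 σ) : ℝ → E) t = _
        rw [ht]
        simp only [Pi.smul_apply, smul_comm c] }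

variable {σ : Measure ℝ}

lemma coeFn_mulOp (f : (mulOp E σ).domain) :
    mulOp E σ f =ᵐ[σ] fun t => (t : ℂ) • (f : Lp E 2 σ) t :=
  MemLp.coeFn_toLp f.2

lemma isHermitian_mulOp : Rigged.IsHermitian (mulOp E σ) := by
  intro f g
  rw [L2.inner_def, L2.inner_def]
  refine integral_congr_ae ?_
  filter_upwards [coeFn_mulOp f, coeFn_mulOp g] with t h1 h2
  rw [h1, h2, inner_smul_left, inner_smul_right, Complex.conj_ofReal]

/-- The resolvent of `mulOp` is multiplication by `(t - z)⁻¹`. -/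
lemma mulOp_resolvent {z : ℂ} (hz : z.im ≠ 0) (h : Lp E 2 σ) :
    ∃ f : (mulOp E σ).domain, mulOp E σ f - z • (f : Lp E 2 σ) = h ∧
      (f : Lp E 2 σ) =ᵐ[σ] fun t => ((t : ℂ) - z)⁻¹ • h t := by
  have hne : ∀ t : ℝ, (t : ℂ) - z ≠ 0 := by
    intro t h0
    apply hz
    rw [← sub_eq_zero.1 h0, Complex.ofReal_im]
  have hmem : MemLp (fun t : ℝ => ((t : ℂ) - z)⁻¹ • h t) 2 σ := by
    refine (Lp.memLp h).of_le_mul (c := |z.im|⁻¹) ?_ (Filter.Eventually.of_forall fun t => ?_)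
    · refine AEStronglyMeasurable.smul (Measurable.aestronglyMeasurable ?_)
        (Lp.memLp h).aestronglyMeasurable
      fun_prop
    · rw [norm_smul, norm_inv]
      gcongr
      calc |z.im| = |((t : ℂ) - z).im| := by simp
        _ ≤ ‖(t : ℂ) - z‖ := Complex.abs_im_le_norm _
  have hcoe := hmem.coeFn_toLp
  -- The identity `t/(t - z) = 1 + z/(t - z)` gives both membership in the domain and the resolvent
  -- equation.
  have hmul : (fun t : ℝ => h t + z • (((t : ℂ) - z)⁻¹ • h t)) =ᵐ[σ]
      fun t : ℝ => (t : ℂ) • (hmem.toLp : Lp E 2 σ) t := by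
    filter_upwards [hcoe] with t ht
    rw [ht, smul_smul, smul_smul]
    nth_rewrite 1 [← one_smul ℂ (h t)]
    rw [← add_smul]
    congr 1
    field_simp [hne t]
    ring
  have hdom : (hmem.toLp : Lp E 2 σ) ∈ (mulOp E σ).domain :=
    ((Lp.memLp h).add (hmem.const_smul z)).ae_eq hmul
  refine ⟨⟨hmem.toLp, hdom⟩, ?_, hcoe⟩
  refine Lp.ext ?_
  filter_upwards [coeFn_mulOp ⟨hmem.toLp, hdom⟩, hmul, hcoe,
    Lp.coeFn_sub (mulOp E σ ⟨hmem.toLp, hdom⟩) (z • hmem.toLp), Lp.coeFn_smul z hmem.toLp]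
    with t h1 h2 h3 h4 h5
  rw [h4, Pi.sub_apply, h1, h5, Pi.smul_apply, ← h2, h3, add_sub_cancel_right]

end MulOp

/-! ### Realization of `V(z) - V(i)` in `L²(σ; E)`. -/

section Realization

open MeasureTheory

variable {E : Type*} [NormedAddCommGroup E] [InnerProductSpace ℂ E]

/-- The vector `(t - i)⁻¹ s(t) e` of `L²(σ; E)`. -/
def cauchyVector {σ : Measure ℝ} {s : ℝ → E →L[ℂ] E}
    (hs : ∀ e, MemLp (fun t : ℝ => ((t : ℂ) - Complex.I)⁻¹ • s t e) 2 σ) : E →ₗ[ℂ] Lp E 2 σ where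
  toFun e := (hs e).toLp
  map_add' x y := by
    rw [← MemLp.toLp_add, MemLp.toLp_eq_toLp_iff]
    exact Filter.Eventually.of_forall fun t => by simp
  map_smul' c x := by
    rw [RingHom.id_apply, ← MemLp.toLp_const_smul, MemLp.toLp_eq_toLp_iff]
    exact Filter.Eventually.of_forall fun t => by simp [smul_comm c]

/-- With `r = (t - z)⁻¹(t - i)⁻¹ s(t) φ` the scalar factors combine by `(z - i)(t + i)/((t - z)(t -
i)(t + i)) = 1/(t - z) - 1/(t - i)`. Conjugates appear because the inner product is antilinear in
its first argument. -/
lemma inner_mulOp_cauchyVector {σ : Measure ℝ} {s : ℝ → E →L[ℂ] E}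
    (hs : ∀ e, MemLp (fun t : ℝ => ((t : ℂ) - Complex.I)⁻¹ • s t e) 2 σ) {z : ℂ} (hz : z.im ≠ 0)
    (φ : E) : ∃ r : (mulOp E σ).domain,
      mulOp E σ r - z • (r : Lp E 2 σ) = cauchyVector hs φ ∧
      ∀ e, conj (z - Complex.I) * ⟪mulOp E σ r + Complex.I • (r : Lp E 2 σ), cauchyVector hs e⟫_ℂ =
        ∫ t : ℝ, conj (1 / ((t : ℂ) - z) - 1 / ((t : ℂ) - Complex.I)) * ⟪s t φ, s t e⟫_ℂ ∂σ := by
  obtain ⟨r, hr, hr'⟩ := mulOp_resolvent hz (cauchyVector hs φ)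
  refine ⟨r, hr, fun e => ?_⟩
  rw [L2.inner_def, ← integral_const_mul]
  refine integral_congr_ae ?_
  filter_upwards [Lp.coeFn_add (mulOp E σ r) (Complex.I • (r : Lp E 2 σ)),
    Lp.coeFn_smul Complex.I (r : Lp E 2 σ), coeFn_mulOp r, hr', (hs φ).coeFn_toLp,
    (hs e).coeFn_toLp] with t h1 h2 h3 h4 h5 h6
  have h5' : (cauchyVector hs φ : ℝ → E) t = ((t : ℂ) - Complex.I)⁻¹ • s t φ := h5
  have h6' : (cauchyVector hs e : ℝ → E) t = ((t : ℂ) - Complex.I)⁻¹ • s t e := h6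
  rw [h1, Pi.add_apply, h2, Pi.smul_apply, h3, h4, h5', h6']
  simp only [inner_add_left, inner_smul_left, inner_smul_right, map_sub, map_div₀, map_one, map_inv₀,
    Complex.conj_I, Complex.conj_ofReal]
  have hz1 : (t : ℂ) - conj z ≠ 0 := by
    intro h0
    apply hz
    rw [← Complex.conj_conj z, ← sub_eq_zero.1 h0]
    simp
  have hi1 : (t : ℂ) - Complex.I ≠ 0 := by
    intro h0
    have := congrArg Complex.im h0
    simp at this
  have hi2 : (t : ℂ) - -Complex.I ≠ 0 := by
    intro h0
    have := congrArg Complex.im h0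
    simp at this
  field_simp
  ring

end Realization

lemma integral_polarization {α : Type*} [MeasurableSpace α] {μ : MeasureTheory.Measure α}
    {f g h k : α → ℂ} (hf : MeasureTheory.Integrable f μ) (hg : MeasureTheory.Integrable g μ)
    (hh : MeasureTheory.Integrable h μ) (hk : MeasureTheory.Integrable k μ) :
    (∫ t, f t ∂μ - ∫ t, g t ∂μ - Complex.I * ∫ t, h t ∂μ + Complex.I * ∫ t, k t ∂μ) / 4 =
      ∫ t, (f t - g t - Complex.I * h t + Complex.I * k t) / 4 ∂μ := by
  rw [MeasureTheory.integral_div, MeasureTheory.integral_add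
      (f := fun t => f t - g t - Complex.I * h t) (g := fun t => Complex.I * k t)
      ((hf.sub hg).sub (hh.const_mul _)) (hk.const_mul _),
    MeasureTheory.integral_sub (f := fun t => f t - g t) (hf.sub hg) (hh.const_mul _),
    MeasureTheory.integral_sub hf hg, MeasureTheory.integral_const_mul,
    MeasureTheory.integral_const_mul]

end

theorem theorem3p2 {E : Type u} [NormedAddCommGroup E] [InnerProductSpace ℂ E] [CompleteSpace E]
    [FiniteDimensional ℂ E] (V : ℂ → E →L[ℂ] E) (hV : IsHerglotzNevanlinna V)
    (Q : E →L[ℂ] E) (hQ : IsSelfAdjoint Q) (S : ℝ → E →L[ℂ] E) (hS : Monotone S)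
    (hSint : ∀ x : E, MeasureTheory.Integrable (fun t : ℝ => 1 / (1 + t ^ 2))
      (quadraticMeasure S hS x))
    (hrep : ∀ z : ℂ, z.im ≠ 0 →
      IsStieltjesIntegral S hS (fun t : ℝ => 1 / ((t : ℂ) - z) - (t : ℂ) / (1 + (t : ℂ) ^ 2))
        (V z - Q)) :
    ∃ (H : Type u) (_ : NormedAddCommGroup H) (_ : InnerProductSpace ℂ H) (_ : CompleteSpace H)
      (A : H →ₗ.[ℂ] H) (D : Rigged.Plus A →L[ℂ] Rigged.Minus A)
      (F : Rigged.Plus A →L[ℂ] Rigged.Plus A) (K : E →L[ℂ] Rigged.Minus A),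
      Rigged.IsImpedanceSystem A D F K ∧
      (∀ z : ℂ, z.im ≠ 0 → z ∈ Rigged.rho D F K ∧
        ∀ φ : E, ∃ f : Rigged.Plus A, Rigged.pencil D F z f = K φ ∧ V z φ = Rigged.adjK K f) ∧
      Rigged.minusOp F ∘L D = D ∘L F := by
  obtain ⟨σ, s, hsm, hσ⟩ := exists_sqrt_density hS
  -- The squared norm is `⟪s e, s e⟫/(1 + t²)`, as `|t - i|² = 1 + t²`; this is the integrability
  -- assumption on `Σ` rewritten through `σ`.
  have hs : ∀ e, MeasureTheory.MemLp (fun t : ℝ => ((t : ℂ) - Complex.I)⁻¹ • s t e) 2 σ := by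
    intro e
    have hmeas : MeasureTheory.AEStronglyMeasurable
        (fun t : ℝ => ((t : ℂ) - Complex.I)⁻¹ • s t e) σ := by
      refine MeasureTheory.AEStronglyMeasurable.smul (Measurable.aestronglyMeasurable ?_)
        (hsm e).aestronglyMeasurable
      fun_prop
    rw [MeasureTheory.memLp_two_iff_integrable_sq_norm hmeas]
    have h1 := (hσ e _ (hSint e).ofReal).1.re
    refine h1.congr (Filter.Eventually.of_forall fun t => ?_)
    have h2 : ‖(t : ℂ) - Complex.I‖ ^ 2 = 1 + t ^ 2 := by
      rw [Complex.sq_norm, Complex.normSq_apply]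
      simp
      ring
    simp only [inner_self_eq_norm_sq_to_K]
    rw [norm_smul, norm_inv, mul_pow, inv_pow, h2]
    change ((((1 / (1 + t ^ 2) : ℝ) : ℂ)) * ((‖s t e‖ : ℝ) : ℂ) ^ 2).re = _
    rw [← Complex.ofReal_pow, ← Complex.ofReal_mul, Complex.ofReal_re, one_div]
  -- Subtracting the representation at `i` cancels `Q` and the regularizing term `t/(1 + t²)`.
  have hquad : ∀ z : ℂ, z.im ≠ 0 → ∀ x : E,
      MeasureTheory.Integrable (fun t : ℝ => conj (1 / ((t : ℂ) - z) - 1 / ((t : ℂ) - Complex.I)) *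
        ⟪s t x, s t x⟫_ℂ) σ ∧ ⟪(V z - V Complex.I) x, x⟫_ℂ =
        ∫ t : ℝ, conj (1 / ((t : ℂ) - z) - 1 / ((t : ℂ) - Complex.I)) * ⟪s t x, s t x⟫_ℂ ∂σ := by
    intro z hz x
    obtain ⟨i1, e1⟩ := hrep z hz x
    obtain ⟨i2, e2⟩ := hrep Complex.I (by simp) x
    have hsub : (fun t : ℝ => (1 / ((t : ℂ) - z) - (t : ℂ) / (1 + (t : ℂ) ^ 2)) -
        (1 / ((t : ℂ) - Complex.I) - (t : ℂ) / (1 + (t : ℂ) ^ 2))) =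
        fun t : ℝ => 1 / ((t : ℂ) - z) - 1 / ((t : ℂ) - Complex.I) := by
      ext t
      ring
    have i3 := i1.sub i2
    have e3 : ⟪x, (V z - V Complex.I) x⟫_ℂ = ∫ t : ℝ, (1 / ((t : ℂ) - z) - 1 / ((t : ℂ) - Complex.I))
        ∂(quadraticMeasure S hS x) := by
      rw [← hsub, MeasureTheory.integral_sub i1 i2, ← e1, ← e2, ← inner_sub_right]
      congr 1
      simp only [sub_apply]
      abel
    replace i3 : MeasureTheory.Integrable
        (fun t : ℝ => 1 / ((t : ℂ) - z) - 1 / ((t : ℂ) - Complex.I)) (quadraticMeasure S hS x) := by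
      rw [← hsub]
      exact i3
    obtain ⟨i4, e4⟩ := hσ x _ i3
    have hconj : (fun t : ℝ => conj (1 / ((t : ℂ) - z) - 1 / ((t : ℂ) - Complex.I)) *
        ⟪s t x, s t x⟫_ℂ) = fun t : ℝ => conj ((1 / ((t : ℂ) - z) - 1 / ((t : ℂ) - Complex.I)) *
        ⟪s t x, s t x⟫_ℂ) := by
      ext t
      rw [map_mul, inner_conj_symm]
    rw [hconj, integral_conj, ← e4, ← e3, inner_conj_symm]
    exact ⟨Complex.conjCLE.toContinuousLinearMap.integrable_comp i4, rfl⟩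
  -- The representation is given only for quadratic forms; polarizing both sides recovers the
  -- sesquilinear identity.
  have hsesq : ∀ z : ℂ, z.im ≠ 0 → ∀ φ e : E, ⟪V z φ, e⟫_ℂ = ⟪V Complex.I φ, e⟫_ℂ +
      ∫ t : ℝ, conj (1 / ((t : ℂ) - z) - 1 / ((t : ℂ) - Complex.I)) * ⟪s t φ, s t e⟫_ℂ ∂σ := by
    intro z hz φ e
    have h1 := inner_map_polarization' (V z - V Complex.I).toLinearMap φ e
    have hpt : ∀ t : ℝ, ⟪s t φ, s t e⟫_ℂ = (⟪s t (φ + e), s t (φ + e)⟫_ℂ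
        - ⟪s t (φ - e), s t (φ - e)⟫_ℂ
        - Complex.I * ⟪s t (φ + Complex.I • e), s t (φ + Complex.I • e)⟫_ℂ
        + Complex.I * ⟪s t (φ - Complex.I • e), s t (φ - Complex.I • e)⟫_ℂ) / 4 := by
      intro t
      have := inner_map_polarization'
        (ContinuousLinearMap.adjoint (s t) ∘L s t).toLinearMap φ e
      simpa only [ContinuousLinearMap.coe_coe, ContinuousLinearMap.comp_apply,
        ContinuousLinearMap.adjoint_inner_left] using this
    simp only [ContinuousLinearMap.coe_coe] at h1
    obtain ⟨j1, q1⟩ := hquad z hz (φ + e)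
    obtain ⟨j2, q2⟩ := hquad z hz (φ - e)
    obtain ⟨j3, q3⟩ := hquad z hz (φ + Complex.I • e)
    obtain ⟨j4, q4⟩ := hquad z hz (φ - Complex.I • e)
    rw [q1, q2, q3, q4, integral_polarization j1 j2 j3 j4, sub_apply, inner_sub_left,
      sub_eq_iff_eq_add'] at h1
    rw [h1]
    congr 1
    refine MeasureTheory.integral_congr_ae (Filter.Eventually.of_forall fun t => ?_)
    simp only [hpt t]
    ring
  refine Rigged.exists_impedanceSystem V ?_ (isHermitian_mulOp (σ := σ))
    (fun z hz h => (mulOp_resolvent hz h).imp fun _ hx => hx.1) (cauchyVector hs) fun z hz φ => ?_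
  · simpa using hV.symmetric Complex.I (by simp)
  · obtain ⟨r, hr, hre⟩ := inner_mulOp_cauchyVector hs hz φ
    exact ⟨r, hr, fun e => by rw [hre, hsesq z hz]⟩
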